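/- Let $p$ be a prime and let $(A,(p))$ be a crystalline prism, i.e. a $p$-torsion free, $p$-adically complete ring $A$ with a $\delta$-structure. Let $R$ be a $p$-completely smooth $A$-algebra ($R$ is $p$-adically complete and $R/p^n$ is smooth over $A/p^n$ for all $n\ge 1$), put $A_0=A/p$, $R_0=R/p$, and suppose given a chart, i.e. an étale map of $A_0$-algebras $\Box\colon A_0[T_1^{\pm1},\dots,T_d^{\pm1}]\to R_0$, together with lifts $T_1,\dots,T_d\in R$ of the $\Box(T_i)$ (coordinates on $R$). Let $\delta_1,\delta_2$ be $\delta$-structures on $R$ compatible with that of $A$ whose Frobenius lifts $\varphi_j(x)=x^p+p\,\delta_j(x)$ satisfy $\varphi_1(x)\equiv\varphi_2(x)\bmod p^2$ for all $x\in R$, and write $R_j$ for $R$ equipped with $\delta_j$. Let $(R_0/A)_{\Delta}$ be the category whose objects are the prisms $(B,(p))$ over $(A,(p))$ (that is, $p$-torsion free, $p$-adically complete $\delta$-rings $B$ with a $\delta$-map $A\to B$) equipped with a map of $A$-algebras $R_0\to B/p$, and whose morphisms are the maps of $\delta$-$A$-algebras compatible with the maps from $R_0$; each $(R_j,(p))$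 is an object via the identity $R_0=R/p$. Let $R_1\widehat\otimes_A R_2$ be the $p$-adic completion of $R\otimes_A R$, let $J$ be the kernel of the diagonal map $R\widehat\otimes_A R\to R$, and write $T_i$ and $S_i$ for the images of the $i$-th coordinate under the first and the second inclusion $R\to R\widehat\otimes_A R$. Then: 1. There is exactly one $\delta$-structure on $R_1\widehat\otimes_A R_2$ for which both inclusions $R_j\to R_1\widehat\otimes_A R_2$ are $\delta$-maps. 2. The coproduct of $(R_1,(p))$ and $(R_2,(p))$ in $(R_0/A)_{\Delta}$ exists and is the prismatic envelope $E=R_1\widehat\otimes_A R_2\{J/p\}^\wedge_p$, i.e. the universal prism $(E,(p))$ over $(A,(p))$ with a map of $\delta$-$A$-algebras $R_1\widehat\otimes_A R_2\to E$ sending $J$ into $pE$; the coprojections $R_j\to E$ are the composites of this map with the inclusions $R_j\to R_1\widehat\otimes_A R_2$. 3. For each $j\in\{1,2\}$ let $R_j[Y_1,\dots,Y_d]^\wedge_{\mathrm{pd}}$ be the $p$-adic completion of the free divided power polynomial algebra over $R$ in $Y_1,\dots,Y_d$. There is exactly one ring map $\psi_j\colon R\widehat\otimes_A R\to R_j[Y_1,\dots,Y_d]^\wedge_{\mathrm{pd}}$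 that restricts to the structure map of the $R$-algebra $R_j[Y_1,\dots,Y_d]^\wedge_{\mathrm{pd}}$ along the $j$-th inclusion, sends $T_i-S_i$ to $pY_i$ for all $i$, and sends $J$ into the ideal $(p)$. With the $R\widehat\otimes_A R$-algebra structure given by $\psi_j$, there is exactly one isomorphism of $R\widehat\otimes_A R$-algebras $$\iota\colon R_j[Y_1,\dots,Y_d]^\wedge_{\mathrm{pd}}\xrightarrow{\ \cong\ } R_1\widehat\otimes_A R_2\{J/p\}^\wedge_p$$ with $p\,\iota(Y_i)=T_i-S_i$, i.e. $\iota(Y_i)=\frac{T_i-S_i}{p}$, for all $i$. In particular $\iota$ is an isomorphism of $R_j$-algebras. -/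

import Mathlib

open CategoryTheory
open scoped TensorProduct

universe u

noncomputable section

namespace CrysPrism

/-! ### `δ`-rings -/

/-- A `δ`-structure (with respect to the prime `p`) on a commutative ring. The integers
`p.choose k / p` for `0 < k < p` are exact quotients. -/
@[ext]
structure DeltaStructure (p : ℕ) (B : Type*) [CommRing B] where
  toFun : B → B
  map_zero' : toFun 0 = 0
  map_one' : toFun 1 = 0
  map_mul' : ∀ x y, toFun (x * y) = x ^ p * toFun y + y ^ p * toFun x + p * toFun x * toFun y
  map_add' : ∀ x y, toFun (x + y) = toFun x + toFun y -
    ∑ k ∈ Finset.Ioo 0 p, ((p.choose k / p : ℕ) : B) * x ^ k * y ^ (p - k)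

instance (p : ℕ) (B : Type*) [CommRing B] : CoeFun (DeltaStructure p B) (fun _ => B → B) :=
  ⟨DeltaStructure.toFun⟩

/-- The Frobenius lift `φ(x) = x ^ p + p δ(x)` attached to a `δ`-structure. -/
def DeltaStructure.frobenius {p : ℕ} {B : Type*} [CommRing B] (δ : DeltaStructure p B) (x : B) : B :=
  x ^ p + p * δ x

/-- A map between `δ`-rings that commutes with the `δ`-structures. -/
def IsDeltaMap {p : ℕ} {B C : Type*} [CommRing B] [CommRing C]
    (δB : DeltaStructure p B) (δC : DeltaStructure p C) (f : B →+* C) : Prop :=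
  ∀ x, f (δB x) = δC (f x)

/-! ### The `p`-adic topology -/

/-- The ideal `(p)` of a ring. -/
abbrev pIdeal (p : ℕ) (B : Type*) [CommRing B] : Ideal B := Ideal.span {(p : B)}

/-- The `p`-adic completion of a ring. -/
abbrev PCompletion (p : ℕ) (B : Type*) [CommRing B] : Type _ := AdicCompletion (pIdeal p B) B

lemma pIdeal_pow_le_comap (p : ℕ) {B C : Type*} [CommRing B] [CommRing C] (f : B →+* C) (n : ℕ) :
    pIdeal p B ^ n ≤ (pIdeal p C ^ n).comap f := by
  rw [← Ideal.map_le_iff_le_comap, Ideal.map_pow, Ideal.map_span]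
  simp

lemma pIdeal_le_comap (p : ℕ) {B C : Type*} [CommRing B] [CommRing C] (f : B →+* C) :
    pIdeal p B ≤ (pIdeal p C).comap f := by
  have h := pIdeal_pow_le_comap p f 1
  rwa [pow_one, pow_one] at h

/-- The reduction `B / p ^ n → C / p ^ n` of a ring map `B → C`. -/
def reductionPow (p : ℕ) {B C : Type*} [CommRing B] [CommRing C] (f : B →+* C) (n : ℕ) :
    B ⧸ pIdeal p B ^ n →+* C ⧸ pIdeal p C ^ n :=
  Ideal.quotientMap _ f (pIdeal_pow_le_comap p f n)

/-- The reduction `B / p → C / p` of a map `B → C` of `A`-algebras. -/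
def reduction (p : ℕ) {A B C : Type*} [CommRing A] [CommRing B] [CommRing C] [Algebra A B]
    [Algebra A C] (f : B →ₐ[A] C) : B ⧸ pIdeal p B →ₐ[A] C ⧸ pIdeal p C :=
  Ideal.quotientMapₐ _ f (pIdeal_le_comap p f.toRingHom)

/-- The condition on a `δ`-ring `B` for `(B, (p))` to be a (crystalline) prism: `B` is
`p`-torsion free and `p`-adically complete. -/
structure IsCrystalline (p : ℕ) (B : Type*) [CommRing B] : Prop where
  torsionFree : ∀ x : B, (p : B) * x = 0 → x = 0
  complete : IsAdicComplete (pIdeal p B) B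

/-- `R` is `p`-completely smooth over `A`, i.e. `Spf R → Spf A` is smooth for the `p`-adic
topologies: `R` is `p`-adically complete, and smooth over `A` modulo every power of `p`. -/
structure IsPCompletelySmooth (p : ℕ) (A R : Type*) [CommRing A] [CommRing R] [Algebra A R] :
    Prop where
  complete : IsAdicComplete (pIdeal p R) R
  smooth : ∀ n : ℕ, (reductionPow p (algebraMap A R) n).Smooth

/-- If `S'` is flat over `S` and every element of `S` killed by `q` lies in `I`, then every element
of `S'` killed by `q` lies in `I S'`. -/
lemma mem_map_of_mul_eq_zero {S S' : Type*} [CommRing S] [CommRing S'] [Algebra S S']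
    [Module.Flat S S'] (q : S) (I : Ideal S) (hI : ∀ s, q * s = 0 → s ∈ I) (x : S')
    (hx : algebraMap S S' q * x = 0) : x ∈ I.map (algebraMap S S') := by
  have hrel : ∑ i : Fin 1, (fun _ : Fin 1 => q) i • (fun _ : Fin 1 => x) i = 0 := by
    rw [Fin.sum_univ_one, Algebra.smul_def, hx]
  obtain ⟨κ, a, y, h1, h2⟩ := Module.Flat.isTrivialRelation_of_sum_smul_eq_zero
    (R := S) (M := S') (f := fun _ : Fin 1 => q) (x := fun _ : Fin 1 => x) hrel
  have hx1 : x = ∑ j, a 0 j • y j := h1 0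
  rw [hx1]
  refine Ideal.sum_mem _ fun j _ => ?_
  have h2j : q * a 0 j = 0 := by
    have := h2 j
    rwa [Fin.sum_univ_one] at this
  rw [Algebra.smul_def]
  exact Ideal.mul_mem_right _ _ (Ideal.mem_map_of_mem _ (hI _ h2j))

/-- A `p`-completely smooth algebra over a crystalline prism is `p`-torsion free. -/
lemma IsPCompletelySmooth.isCrystalline {p : ℕ} {A R : Type*} [CommRing A] [CommRing R]
    [Algebra A R] (hR : IsPCompletelySmooth p A R) (hA : IsCrystalline p A) :
    IsCrystalline p R where
  complete := hR.complete
  torsionFree x hx := by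
    refine hR.complete.toIsHausdorff.haus x fun n => ?_
    rw [SModEq.zero, smul_eq_mul, Ideal.mul_top]
    let := (reductionPow p (algebraMap A R) (n + 1)).toAlgebra
    have : Module.Flat (A ⧸ pIdeal p A ^ (n + 1)) (R ⧸ pIdeal p R ^ (n + 1)) :=
      (hR.smooth (n + 1)).flat
    have hmem := mem_map_of_mul_eq_zero (p : A ⧸ pIdeal p A ^ (n + 1))
      ((pIdeal p A ^ n).map (Ideal.Quotient.mk (pIdeal p A ^ (n + 1))))
      (by
        intro s hs
        obtain ⟨b, rfl⟩ := Ideal.Quotient.mk_surjective s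
        rw [← map_natCast (Ideal.Quotient.mk (pIdeal p A ^ (n + 1))), ← map_mul,
          Ideal.Quotient.eq_zero_iff_mem, Ideal.span_singleton_pow,
          Ideal.mem_span_singleton] at hs
        refine Ideal.mem_map_of_mem _ ?_
        rw [Ideal.span_singleton_pow, Ideal.mem_span_singleton]
        obtain ⟨c, hc⟩ := hs
        refine ⟨c, sub_eq_zero.1 (hA.torsionFree _ ?_)⟩
        rw [mul_sub, hc]
        ring)
      (Ideal.Quotient.mk _ x)
      (by rw [map_natCast, ← map_natCast (Ideal.Quotient.mk (pIdeal p R ^ (n + 1))), ← map_mul,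
        hx, map_zero])
    rw [RingHom.algebraMap_toAlgebra, Ideal.map_map] at hmem
    have hcomp : (reductionPow p (algebraMap A R) (n + 1)).comp
        (Ideal.Quotient.mk (pIdeal p A ^ (n + 1))) =
        (Ideal.Quotient.mk (pIdeal p R ^ (n + 1))).comp (algebraMap A R) := rfl
    rw [hcomp, ← Ideal.map_map] at hmem
    obtain ⟨z, hz, hzx⟩ := (Ideal.mem_map_iff_of_surjective _
      Ideal.Quotient.mk_surjective).1 hmem
    have hz' : z ∈ pIdeal p R ^ n :=
      Ideal.map_le_iff_le_comap.2 (pIdeal_pow_le_comap p (algebraMap A R) n) hz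
    rw [Ideal.Quotient.eq] at hzx
    have := Ideal.sub_mem _ hz' (Ideal.pow_le_pow_right (Nat.le_succ n) hzx)
    rwa [sub_sub_cancel] at this

/-! ### The category of prisms over `R₀` relative to `(A, (p))` -/

/-- An object of `(R₀ / A)_Δ`, for a crystalline prism `(A, (p))` and an `A / p`-algebra `R₀`:
a prism `(B, (p))` over `(A, (p))` together with a map of `A`-algebras `R₀ → B / p`.
(A prism over `(A, (p))` has `pB` as its ideal, and is automatically bounded.) -/
structure PrismObj {p : ℕ} {A : Type u} [CommRing A] (δA : DeltaStructure p A)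
    (R₀ : Type u) [CommRing R₀] [Algebra A R₀] where
  carrier : Type u
  [commRing : CommRing carrier]
  [algebra : Algebra A carrier]
  δ : DeltaStructure p carrier
  isCrystalline : IsCrystalline p carrier
  isDeltaMap : IsDeltaMap δA δ (algebraMap A carrier)
  str : R₀ →ₐ[A] carrier ⧸ pIdeal p carrier

attribute [instance] PrismObj.commRing PrismObj.algebra

/-- Morphisms of prisms over `R₀` relative to `A`, in the direction of the ring maps. -/
@[ext]
structure PrismHom {p : ℕ} {A : Type u} [CommRing A] {δA : DeltaStructure p A}
    {R₀ : Type u} [CommRing R₀] [Algebra A R₀] (X Y : PrismObj δA R₀) where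
  toAlgHom : X.carrier →ₐ[A] Y.carrier
  isDeltaMap : IsDeltaMap X.δ Y.δ toAlgHom.toRingHom
  reduction_comp_str : (reduction p toAlgHom).comp X.str = Y.str

instance {p : ℕ} {A : Type u} [CommRing A] {δA : DeltaStructure p A}
    {R₀ : Type u} [CommRing R₀] [Algebra A R₀] : Category (PrismObj δA R₀) where
  Hom X Y := PrismHom X Y
  id X :=
    { toAlgHom := AlgHom.id A _
      isDeltaMap := fun _ => rfl
      reduction_comp_str := by
        ext x
        obtain ⟨y, hy⟩ := Ideal.Quotient.mk_surjective (X.str x)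
        simp only [AlgHom.comp_apply, ← hy]
        rfl }
  comp {X Y Z} f g :=
    { toAlgHom := g.toAlgHom.comp f.toAlgHom
      isDeltaMap := fun x =>
        (congrArg g.toAlgHom (f.isDeltaMap x)).trans (g.isDeltaMap (f.toAlgHom x))
      reduction_comp_str := by
        rw [← g.reduction_comp_str, ← f.reduction_comp_str]
        ext x
        obtain ⟨y, hy⟩ := Ideal.Quotient.mk_surjective (X.str x)
        simp only [AlgHom.comp_apply, ← hy]
        rfl }

/-- A `p`-completely smooth `A`-algebra `R` with a `δ`-structure over `A`, as an object of
`(R₀ / A)_Δ` for `R₀ = R / p`. -/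
abbrev PrismObj.ofDelta {p : ℕ} {A R : Type u} [CommRing A] [CommRing R] [Algebra A R]
    {δA : DeltaStructure p A} (hA : IsCrystalline p A) (hR : IsPCompletelySmooth p A R)
    (δ : DeltaStructure p R) (hδ : IsDeltaMap δA δ (algebraMap A R)) :
    PrismObj δA (R ⧸ pIdeal p R) where
  carrier := R
  δ := δ
  isCrystalline := hR.isCrystalline hA
  isDeltaMap := hδ
  str := AlgHom.id A _

/-! ### Prismatic envelopes -/

/-- `f : C → E` exhibits the prism `(E, (p))` as the prismatic envelope `C{J/p}^∧` of the
`δ`-`A`-algebra `C` along the ideal `J`: it is the universal map of `δ`-`A`-algebras from `C` to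
a prism over `(A, (p))` that sends `J` into the ideal `(p)`. -/
structure IsPrismaticEnvelope {p : ℕ} {A C E : Type u} [CommRing A] [CommRing C] [CommRing E]
    [Algebra A C] [Algebra A E] (δA : DeltaStructure p A) (δC : DeltaStructure p C) (J : Ideal C)
    (δE : DeltaStructure p E) (f : C →ₐ[A] E) : Prop where
  isCrystalline : IsCrystalline p E
  isDeltaMap_algebraMap : IsDeltaMap δA δE (algebraMap A E)
  isDeltaMap : IsDeltaMap δC δE f.toRingHom
  map_le : J.map f ≤ pIdeal p E
  existsUnique_lift : ∀ (B : Type u) [CommRing B] [Algebra A B] (δB : DeltaStructure p B),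
    IsCrystalline p B → IsDeltaMap δA δB (algebraMap A B) →
    ∀ g : C →ₐ[A] B, IsDeltaMap δC δB g.toRingHom → J.map g ≤ pIdeal p B →
      ∃! h : E →ₐ[A] B, IsDeltaMap δE δB h.toRingHom ∧ h.comp f = g

/-! ### The completed tensor product and the diagonal -/

/-- The completed tensor product `R ⊗̂_A R`. -/
abbrev CompletedTensor (p : ℕ) (A R : Type u) [CommRing A] [CommRing R] [Algebra A R] : Type u :=
  PCompletion p (R ⊗[A] R)

/-- The two inclusions `R → R ⊗̂_A R`: `r ↦ r ⊗ 1` for `j = 0` and `r ↦ 1 ⊗ r` for `j = 1`. -/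
def incl (p : ℕ) (A R : Type u) [CommRing A] [CommRing R] [Algebra A R] (j : Fin 2) :
    R →ₐ[A] CompletedTensor p A R :=
  (Algebra.algHom A (R ⊗[A] R) (CompletedTensor p A R)).comp
    (![Algebra.TensorProduct.includeLeft, Algebra.TensorProduct.includeRight] j)

/-- The diagonal `Δ : R ⊗̂_A R → R`, the continuous extension of the multiplication of a
`p`-adically complete algebra `R`. -/
def diagonal (p : ℕ) (A R : Type u) [CommRing A] [CommRing R] [Algebra A R]
    (hR : IsAdicComplete (pIdeal p R) R) : CompletedTensor p A R →ₐ[A] R :=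
  haveI := hR
  IsAdicComplete.liftAlgHom (pIdeal p R)
    (fun n => (Ideal.quotientMapₐ (pIdeal p R ^ n) (Algebra.TensorProduct.lmul' A)
      (pIdeal_pow_le_comap p (Algebra.TensorProduct.lmul' A (S := R)).toRingHom n)).comp
      ((AdicCompletion.evalₐ (pIdeal p (R ⊗[A] R)) n).restrictScalars A))
    (by
      intro m n hle
      ext x
      obtain ⟨x, rfl⟩ := AdicCompletion.mk_surjective _ _ x
      have h := congrArg (Ideal.Quotient.mk (pIdeal p R ^ m))
        (show Algebra.TensorProduct.lmul' A (x.val n - x.val m) = _ from map_sub _ _ _)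
      have hx : x.val n - x.val m ∈ pIdeal p (R ⊗[A] R) ^ m := by
        rw [← Ideal.Quotient.eq]
        exact AdicCompletion.Ideal.mk_eq_mk _ hle x
      have h0 := pIdeal_pow_le_comap p (Algebra.TensorProduct.lmul' A (S := R)).toRingHom m hx
      rw [Ideal.mem_comap, ← Ideal.Quotient.eq_zero_iff_mem] at h0
      have h1 := h.symm.trans h0
      rw [map_sub, sub_eq_zero] at h1
      simp only [AlgHom.comp_apply, AlgHom.restrictScalars_apply, AdicCompletion.evalₐ_mk]
      exact h1)

/-- The kernel `J` of the diagonal `R ⊗̂_A R → R`. -/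
def diagonalIdeal (p : ℕ) (A R : Type u) [CommRing A] [CommRing R] [Algebra A R]
    (hR : IsAdicComplete (pIdeal p R) R) : Ideal (CompletedTensor p A R) :=
  RingHom.ker (diagonal p A R hR)

/-! ### Charts and divided power polynomials -/

/-- The Laurent polynomial ring `k[T₁^{±1}, …, T_d^{±1}]`. -/
abbrev LaurentRing (k : Type*) [CommRing k] (d : ℕ) : Type _ := AddMonoidAlgebra k (Fin d → ℤ)

/-- The variable `T_i` of the Laurent polynomial ring. -/
def LaurentRing.X {k : Type*} [CommRing k] {d : ℕ} (i : Fin d) : LaurentRing k d :=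
  AddMonoidAlgebra.single (Pi.single i 1) 1

/-- The `p`-completed free divided power algebra `R[Y₁, …, Y_d]_pd^∧`: the `p`-adic completion of
the divided power algebra of the free module `R^d`. -/
abbrev PdPolynomial (p : ℕ) (R : Type u) [CommRing R] (d : ℕ) : Type u :=
  PCompletion p (DividedPowerAlgebra R (Fin d → R))

/-- The variable `Y_i` of `R[Y₁, …, Y_d]_pd^∧`. -/
def PdPolynomial.Y {p : ℕ} {R : Type u} [CommRing R] {d : ℕ} (i : Fin d) : PdPolynomial p R d :=
  algebraMap (DividedPowerAlgebra R (Fin d → R)) _ (DividedPowerAlgebra.dp R 1 (Pi.single i 1))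

/-- `ψ` is the structure map of the `R ⊗̂_A R`-algebra `R_j[Y₁, …, Y_d]_pd^∧`: it extends the
`R_j`-algebra structure along the `j`-th inclusion, makes `T_i - S_i` equal to `p Y_i`, and sends
the kernel `J` of the diagonal into the ideal `(p)`. -/
structure IsPdStructureMap {p : ℕ} {A R : Type u} [CommRing A] [CommRing R] [Algebra A R]
    (hR : IsAdicComplete (pIdeal p R) R) {d : ℕ} (T : Fin d → R) (j : Fin 2)
    (ψ : CompletedTensor p A R →+* PdPolynomial p R d) : Prop where
  map_incl : ∀ r, ψ (incl p A R j r) = algebraMap R (PdPolynomial p R d) r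
  map_sub : ∀ i, ψ (incl p A R 0 (T i) - incl p A R 1 (T i)) = (p : PdPolynomial p R d) * PdPolynomial.Y i
  map_le : (diagonalIdeal p A R hR).map ψ ≤ pIdeal p (PdPolynomial p R d)

end CrysPrism

end

open CrysPrism

namespace CrysPrism

/-! ### The `p`-adic topology and the `p`-adic completion -/

section PAdic

variable {p : ℕ} {B : Type*} [CommRing B]

/-! Put `x_i = T_i - S_i`, and let `B` be a prism receiving `R ⊗̂ R` with `J` going into `pB`, so
that `x_i = p y_i` in `B`. Since `φ₁ ≡ φ₂` mod `p²`, the element `δ(x_i)` lies in `J + (p)`, so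
`φ(x_i) = x_i^p + p δ(x_i)` becomes divisible by `p²` in `B` (`sq_dvd_frobenius_sub`). Cancelling
`p` in `φ(x_i) = p φ(y_i)` gives `p ∣ φ(y_i)`, hence `p ∣ y_i^p`, and in a `p`-torsion free `δ`-ring
this forces `n! ∣ y_i^n` for all `n` (`IsCrystalline.hasDividedPowers_of_dvd_pow`). So `Y_i ↦ y_i`
defines a map `R_j[Y]_pd^∧ → B`.

Conversely, in `R_j[Y]_pd^∧` the same divisibility dictates `φ(Y_i) = φ(x_i)/p`, an element of
`(p)`. This is a Frobenius lift, because `γ_n(m)^p` and `γ_n(φ(m))` lie in `(p)` for `n > 0` and `m`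
a linear form in the `Y_i` (`PdPolynomial.dvd_sub_pow`). Hence the divided power ring is itself the
universal prism (`exists_isUniversalPrism`).

The chart enters through derivations: modulo `p`, an `A`-derivation of `R` is freely determined by
its values on the `T_i`. Climbing the powers of `p`, a ring map on `R` with given reduction mod `p`
and given restriction to `A` amounts to a choice of lifts of the images of the `T_i`
(`IsCoordinates.ringHom_ext`, `IsCoordinates.exists_lift`). This yields `ψ_j` and reduces equalities
of maps out of `R ⊗̂ R` to one factor and the `x_i` (`ringHom_ext_of_coordinates`).

The universal property does not mention `j`, so `ι` is the comparison of two universal objects. It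
also gives the coproduct: two morphisms from `R₁` and `R₂` to a prism over `R₀` form one `δ`-map on
`R ⊗̂ R` identifying the inclusions mod `p`, which means that `J` goes into `(p)`
(`map_diagonalIdeal_le_iff`). -/

lemma mem_pIdeal_pow {n : ℕ} {x : B} : x ∈ pIdeal p B ^ n ↔ (p : B) ^ n ∣ x := by
  rw [Ideal.span_singleton_pow, Ideal.mem_span_singleton]

lemma mem_pIdeal {x : B} : x ∈ pIdeal p B ↔ (p : B) ∣ x := Ideal.mem_span_singleton

lemma mk_pIdeal_pow_eq {n : ℕ} {x y : B} :
    Ideal.Quotient.mk (pIdeal p B ^ n) x = Ideal.Quotient.mk (pIdeal p B ^ n) y ↔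
      (p : B) ^ n ∣ x - y := by
  rw [Ideal.Quotient.eq, mem_pIdeal_pow]

lemma mk_pIdeal_eq {x y : B} :
    Ideal.Quotient.mk (pIdeal p B) x = Ideal.Quotient.mk (pIdeal p B) y ↔ (p : B) ∣ x - y := by
  rw [Ideal.Quotient.eq, mem_pIdeal]

lemma eq_of_forall_pow_dvd_sub [IsHausdorff (pIdeal p B) B] {x y : B}
    (h : ∀ n, (p : B) ^ n ∣ x - y) : x = y := by
  rw [← sub_eq_zero]
  refine IsHausdorff.haus' (I := pIdeal p B) _ fun n => ?_
  rw [SModEq.zero, smul_eq_mul, Ideal.mul_top, mem_pIdeal_pow]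
  exact h n

namespace IsCrystalline

variable (hB : IsCrystalline p B)
include hB

lemma cancel {x y : B} (h : (p : B) * x = p * y) : x = y :=
  sub_eq_zero.1 (hB.torsionFree _ (by rw [mul_sub, h, sub_self]))

lemma cancel_pow (n : ℕ) {x y : B} (h : (p : B) ^ n * x = p ^ n * y) : x = y := by
  induction n with
  | zero => simpa using h
  | succ n ih =>
    refine ih (hB.cancel ?_)
    rw [← mul_assoc, ← mul_assoc, ← pow_succ', h]

lemma dvd_of_pow_mul_dvd {m n : ℕ} {x : B} (h : (p : B) ^ (n + m) ∣ p ^ n * x) :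
    (p : B) ^ m ∣ x := by
  obtain ⟨c, hc⟩ := h
  exact ⟨c, hB.cancel_pow n (by rw [hc, pow_add, mul_assoc])⟩

lemma eq_of_forall {x y : B} (h : ∀ n, (p : B) ^ n ∣ x - y) : x = y :=
  haveI := hB.complete
  eq_of_forall_pow_dvd_sub h

lemma isUnit_natCast_of_coprime {m : ℕ} (hm : m.Coprime p) : IsUnit (m : B) := by
  have := hB.complete
  have hj : (p : B) ∈ Ideal.jacobson ⊥ :=
    IsAdicComplete.le_jacobson_bot (pIdeal p B) (Ideal.mem_span_singleton_self _)
  obtain ⟨a, b, hab⟩ := Nat.isCoprime_iff_coprime.2 hm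
  -- By Bézout `m a = 1 - p b`, a unit because `p` lies in the Jacobson radical.
  have h1 := (Ideal.mem_jacobson_bot.1 hj) (-(b : B))
  have h2 : (m : B) * a = p * -(b : B) + 1 := by
    have := congrArg (Int.cast : ℤ → B) hab
    push_cast at this
    linear_combination this
  rw [← h2] at h1
  exact isUnit_of_mul_isUnit_left h1

/-- A nonzero integer is a power of `p` up to a unit. -/
lemma natCast_eq_pow_mul_isUnit [Fact p.Prime] {m : ℕ} (hm : m ≠ 0) :
    ∃ u : B, IsUnit u ∧ (m : B) = p ^ padicValNat p m * u := by
  have hp := (Fact.out : p.Prime)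
  refine ⟨((m / p ^ padicValNat p m : ℕ) : B), hB.isUnit_natCast_of_coprime ?_, ?_⟩
  · rw [← Nat.factorization_def m hp]
    exact (Nat.coprime_ordCompl hp hm).symm
  · rw [← Nat.cast_pow, ← Nat.cast_mul, Nat.mul_div_cancel' pow_padicValNat_dvd]

lemma natCast_dvd_iff [Fact p.Prime] {m : ℕ} (hm : m ≠ 0) {x : B} :
    (m : B) ∣ x ↔ (p : B) ^ padicValNat p m ∣ x := by
  obtain ⟨u, hu, h⟩ := hB.natCast_eq_pow_mul_isUnit hm
  rw [h, hu.mul_right_dvd]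

lemma natCast_cancel [Fact p.Prime] {m : ℕ} (hm : m ≠ 0) {x y : B} (h : (m : B) * x = m * y) :
    x = y := by
  obtain ⟨u, hu, hm'⟩ := hB.natCast_eq_pow_mul_isUnit hm
  rw [hm', mul_assoc, mul_assoc] at h
  exact hu.mul_left_cancel (hB.cancel_pow _ h)

end IsCrystalline

end PAdic

section Completion

variable {p : ℕ} {D : Type*} [CommRing D]

lemma PCompletion.isAdicComplete :
    IsAdicComplete (pIdeal p (PCompletion p D)) (PCompletion p D) := by
  have h : IsAdicComplete (pIdeal p D) (PCompletion p D) :=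
    AdicCompletion.isAdicComplete ⟨{(p : D)}, by simp⟩
  have h2 : pIdeal p (PCompletion p D) = (pIdeal p D).map (algebraMap D _) := by
    rw [Ideal.map_span, Set.image_singleton, map_natCast]
  rw [h2]
  exact (IsAdicComplete.map_algebraMap_iff ..).2 h

lemma PCompletion.evalₐ_eq_zero_iff {n : ℕ} {c : PCompletion p D} :
    AdicCompletion.evalₐ (pIdeal p D) n c = 0 ↔ (p : PCompletion p D) ^ n ∣ c := by
  have h1 := SetLike.ext_iff.1 (AdicCompletion.pow_smul_top_eq_ker_eval (I := pIdeal p D) (M := D)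
    (n := n) ⟨{(p : D)}, by simp⟩) c
  have h2 : AdicCompletion.evalₐ (pIdeal p D) n c = 0 ↔
      AdicCompletion.eval (pIdeal p D) D n c = 0 := by
    obtain ⟨x, rfl⟩ := AdicCompletion.mk_surjective _ _ c
    rw [AdicCompletion.evalₐ_mk, Ideal.Quotient.eq_zero_iff_mem]
    change _ ↔ Submodule.Quotient.mk (p := (pIdeal p D ^ n • ⊤ : Submodule D D)) (x.1 n) = 0
    rw [Submodule.Quotient.mk_eq_zero, smul_eq_mul, Ideal.mul_top]
  rw [h2, ← LinearMap.mem_ker, ← h1, Ideal.span_singleton_pow,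
    Submodule.ideal_span_singleton_smul, Submodule.mem_smul_pointwise_iff_exists]
  have h3 (y : PCompletion p D) : (p : D) ^ n • y = (p : PCompletion p D) ^ n * y := by
    rw [Algebra.smul_def, map_pow, map_natCast]
  simp only [h3, Submodule.mem_top, true_and]
  exact ⟨fun ⟨y, hy⟩ => ⟨y, hy.symm⟩, fun ⟨y, hy⟩ => ⟨y, hy.symm⟩⟩

lemma PCompletion.evalₐ_algebraMap {n : ℕ} (x : D) :
    AdicCompletion.evalₐ (pIdeal p D) n (algebraMap D _ x) = Ideal.Quotient.mk _ x := by
  simp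

lemma PCompletion.pow_dvd_algebraMap_iff {n : ℕ} {x : D} :
    (p : PCompletion p D) ^ n ∣ algebraMap D (PCompletion p D) x ↔ (p : D) ^ n ∣ x := by
  rw [← PCompletion.evalₐ_eq_zero_iff, PCompletion.evalₐ_algebraMap,
    Ideal.Quotient.eq_zero_iff_mem, mem_pIdeal_pow]

lemma PCompletion.exists_pow_dvd_sub (c : PCompletion p D) (n : ℕ) :
    ∃ x : D, (p : PCompletion p D) ^ n ∣ c - algebraMap D _ x := by
  obtain ⟨x, hx⟩ := Ideal.Quotient.mk_surjective (AdicCompletion.evalₐ (pIdeal p D) n c)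
  refine ⟨x, ?_⟩
  rw [← PCompletion.evalₐ_eq_zero_iff, map_sub, PCompletion.evalₐ_algebraMap, hx, sub_self]

lemma PCompletion.ringHom_ext {B : Type*} [CommRing B] [IsHausdorff (pIdeal p B) B]
    {f g : PCompletion p D →+* B}
    (h : ∀ x, f (algebraMap D _ x) = g (algebraMap D _ x)) : f = g := by
  ext c
  refine eq_of_forall_pow_dvd_sub (p := p) fun n => ?_
  obtain ⟨x, y, hy⟩ := PCompletion.exists_pow_dvd_sub c n
  obtain rfl : c = algebraMap D _ x + p ^ n * y := by rw [← hy]; ring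
  refine ⟨f y - g y, ?_⟩
  simp only [map_add, map_mul, map_pow, map_natCast, h]
  ring

/-- A ring map from `D` to a `p`-adically complete ring extends to the `p`-adic completion. -/
lemma PCompletion.exists_lift {B : Type*} [CommRing B] (hB : IsAdicComplete (pIdeal p B) B)
    (f : D →+* B) : ∃ F : PCompletion p D →+* B, ∀ x, F (algebraMap D _ x) = f x := by
  let g (n : ℕ) : PCompletion p D →+* B ⧸ pIdeal p B ^ n :=
    (reductionPow p f n).comp (AdicCompletion.evalₐ (pIdeal p D) n).toRingHom
  have hg : ∀ (n : ℕ) (c : PCompletion p D) (x : D),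
      (p : PCompletion p D) ^ n ∣ c - algebraMap D _ x →
      g n c = Ideal.Quotient.mk _ (f x) := by
    intro n c x h
    rw [← PCompletion.evalₐ_eq_zero_iff, map_sub, PCompletion.evalₐ_algebraMap, sub_eq_zero] at h
    change reductionPow p f n (AdicCompletion.evalₐ (pIdeal p D) n c) = _
    rw [h]
    rfl
  refine ⟨IsAdicComplete.liftRingHom (pIdeal p B) g ?_, fun x => ?_⟩
  · intro m n hle
    ext c
    obtain ⟨x, hx⟩ := PCompletion.exists_pow_dvd_sub c n
    rw [RingHom.comp_apply, hg n c x hx, hg m c x ((pow_dvd_pow _ hle).trans hx)]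
    rfl
  · refine eq_of_forall_pow_dvd_sub (p := p) fun n => ?_
    rw [← mk_pIdeal_pow_eq, IsAdicComplete.mk_liftRingHom, hg n _ x (by simp)]

/-- The hypothesis is weaker than torsion-freeness of `D`: it tolerates torsion that dies in the
completion. For `R ⊗[A] R` only flatness modulo powers of `p` is at hand, and that yields exactly
this form. -/
lemma PCompletion.isCrystalline
    (h : ∀ (n : ℕ) (x : D), (p : D) ^ (n + 1) ∣ p * x → (p : D) ^ n ∣ x) :
    IsCrystalline p (PCompletion p D) where
  complete := PCompletion.isAdicComplete
  torsionFree c hc := by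
    have := PCompletion.isAdicComplete (p := p) (D := D)
    refine eq_of_forall_pow_dvd_sub (p := p) fun n => ?_
    obtain ⟨x, hx⟩ := PCompletion.exists_pow_dvd_sub c (n + 1)
    have h1 : (p : PCompletion p D) ^ (n + 1) ∣ algebraMap D _ (p * x) := by
      have h2 := hx.mul_left (-(p : PCompletion p D))
      convert h2 using 1
      rw [map_mul, map_natCast]
      linear_combination hc
    have h3 := PCompletion.pow_dvd_algebraMap_iff.2
      (h n x (PCompletion.pow_dvd_algebraMap_iff.1 h1))
    have h4 := dvd_add ((pow_dvd_pow _ n.le_succ).trans hx) h3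
    simpa using h4

end Completion


/-! ### Frobenius lifts -/

section Frobenius

variable {p : ℕ} [Fact p.Prime] {B C : Type*} [CommRing B] [CommRing C]

lemma add_pow_eq_sum_Ioo (x y : B) : (x + y) ^ p = x ^ p + y ^ p +
    p * ∑ k ∈ Finset.Ioo 0 p, ((p.choose k / p : ℕ) : B) * x ^ k * y ^ (p - k) := by
  rw [add_pow_prime_eq' Fact.out]
  congr 2
  exact Finset.sum_congr rfl fun k _ => by ring

lemma dvd_map_sub_pow_add {F : B →+* B} {x y : B} (hx : (p : B) ∣ F x - x ^ p)
    (hy : (p : B) ∣ F y - y ^ p) : (p : B) ∣ F (x + y) - (x + y) ^ p := by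
  rw [map_add, add_pow_eq_sum_Ioo, ← sub_sub, add_sub_add_comm]
  exact (hx.add hy).sub (dvd_mul_right _ _)

omit [Fact p.Prime] in
lemma dvd_map_sub_pow_mul {F : B →+* B} {x y : B} (hx : (p : B) ∣ F x - x ^ p)
    (hy : (p : B) ∣ F y - y ^ p) : (p : B) ∣ F (x * y) - (x * y) ^ p := by
  rw [map_mul, mul_pow]
  convert (hx.mul_right (F y)).add (hy.mul_left (x ^ p)) using 1
  ring

lemma dvd_map_sub_pow_natCast_mul (F : B →+* B) (x : B) : (p : B) ∣ F (p * x) - (p * x) ^ p := by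
  rw [map_mul, map_natCast, mul_pow]
  exact (dvd_mul_right _ _).sub ((dvd_pow_self _ (Fact.out : p.Prime).ne_zero).mul_right _)

/-- It is enough to check that a map is a Frobenius lift on a `p`-adically dense subring. -/
lemma PCompletion.dvd_map_sub_pow {D : Type*} [CommRing D] (F : PCompletion p D →+* PCompletion p D)
    (h : ∀ x : D, (p : PCompletion p D) ∣ F (algebraMap _ _ x) - algebraMap _ _ x ^ p)
    (c : PCompletion p D) : (p : PCompletion p D) ∣ F c - c ^ p := by
  obtain ⟨x, y, hy⟩ := PCompletion.exists_pow_dvd_sub c 1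
  obtain rfl : c = algebraMap _ _ x + p * y := by rw [← pow_one (p : PCompletion p D), ← hy]; ring
  exact dvd_map_sub_pow_add (h x) (dvd_map_sub_pow_natCast_mul F y)

/-- The Frobenius lift of a `δ`-structure, as a ring map. -/
noncomputable def DeltaStructure.frobeniusHom (δ : DeltaStructure p B) : B →+* B where
  toFun := δ.frobenius
  map_zero' := by
    simp [DeltaStructure.frobenius, δ.map_zero', (Fact.out : p.Prime).ne_zero]
  map_one' := by simp [DeltaStructure.frobenius, δ.map_one']
  map_mul' x y := by
    simp only [DeltaStructure.frobenius, δ.map_mul', mul_pow]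
    ring
  map_add' x y := by
    simp only [DeltaStructure.frobenius, δ.map_add', add_pow_eq_sum_Ioo x y]
    ring

lemma DeltaStructure.frobeniusHom_apply (δ : DeltaStructure p B) (x : B) :
    δ.frobeniusHom x = x ^ p + p * δ x := rfl

lemma DeltaStructure.dvd_frobeniusHom_sub (δ : DeltaStructure p B) (x : B) :
    (p : B) ∣ δ.frobeniusHom x - x ^ p :=
  ⟨δ x, by rw [δ.frobeniusHom_apply]; ring⟩

lemma IsDeltaMap.frobeniusHom_apply {δB : DeltaStructure p B} {δC : DeltaStructure p C}
    {f : B →+* C} (hf : IsDeltaMap δB δC f) (x : B) :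
    f (δB.frobeniusHom x) = δC.frobeniusHom (f x) := by
  simp only [DeltaStructure.frobeniusHom_apply, map_add, map_mul, map_pow, map_natCast, hf x]

lemma IsCrystalline.isDeltaMap (hC : IsCrystalline p C) {δB : DeltaStructure p B}
    {δC : DeltaStructure p C} {f : B →+* C}
    (hf : ∀ x, f (δB.frobeniusHom x) = δC.frobeniusHom (f x)) : IsDeltaMap δB δC f := by
  intro x
  have h := hf x
  simp only [DeltaStructure.frobeniusHom_apply, map_add, map_mul, map_pow, map_natCast] at h
  exact hC.cancel (add_left_cancel h)

lemma IsCrystalline.deltaStructure_ext (hB : IsCrystalline p B) {δ δ' : DeltaStructure p B}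
    (h : ∀ x, δ.frobeniusHom x = δ'.frobeniusHom x) : δ = δ' := by
  ext x
  exact hB.cancel (add_left_cancel (h x))

/-- On a `p`-torsion free ring, a Frobenius lift comes from a `δ`-structure. -/
lemma IsCrystalline.exists_deltaStructure (hB : IsCrystalline p B) (φ : B →+* B)
    (hφ : ∀ x, (p : B) ∣ φ x - x ^ p) :
    ∃ δ : DeltaStructure p B, ∀ x, δ.frobeniusHom x = φ x := by
  choose D hD using hφ
  have hD' (x : B) : (p : B) * D x = φ x - x ^ p := (hD x).symm
  refine ⟨⟨D, hB.cancel ?_, hB.cancel ?_, fun x y => hB.cancel ?_, fun x y => hB.cancel ?_⟩,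
    fun x => ?_⟩
  · rw [hD', map_zero, zero_pow (Fact.out : p.Prime).ne_zero, sub_zero, mul_zero]
  · rw [hD', map_one, one_pow, sub_self, mul_zero]
  · rw [hD', map_mul, mul_pow]
    linear_combination (-y ^ p - p * D y) * hD' x - φ x * hD' y
  · rw [mul_sub, hD', map_add, add_pow_eq_sum_Ioo x y]
    linear_combination - hD' x - hD' y
  · rw [DeltaStructure.frobeniusHom_apply]
    change x ^ p + p * D x = φ x
    rw [hD']
    ring

end Frobenius


/-! ### Lifting along étale and smooth maps -/

section Lifting

/-- Unbundled form of infinitesimal uniqueness, for test rings that carry no algebra structure in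
advance. -/
lemma _root_.RingHom.FormallyUnramified.eq_of_comp_eq {L S Q k : Type*} [CommRing L] [CommRing S]
    [CommRing Q] [CommRing k] {b : L →+* S} (hb : b.FormallyUnramified) (π : Q →+* k)
    (hker : IsNilpotent (RingHom.ker π)) {G G' : S →+* Q} (h : ∀ x, π (G x) = π (G' x))
    (h' : ∀ x, G (b x) = G' (b x)) : G = G' := by
  let := b.toAlgebra
  let := (G.comp b).toAlgebra
  let := (π.comp (G.comp b)).toAlgebra
  have : Algebra.FormallyUnramified L S := hb
  let π' : Q →ₐ[L] k := { π with commutes' := fun _ => rfl }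
  let g : S →ₐ[L] Q := { G with commutes' := fun x => rfl }
  let g' : S →ₐ[L] Q := { G' with commutes' := fun x => (h' x).symm }
  have := Algebra.FormallyUnramified.lift_unique' π' hker g g' (AlgHom.ext h)
  exact RingHom.ext fun x => DFunLike.congr_fun this x

lemma _root_.RingHom.FormallySmooth.exists_lift {L S Q k : Type*} [CommRing L] [CommRing S]
    [CommRing Q] [CommRing k] {b : L →+* S} (hb : b.FormallySmooth) (π : Q →+* k)
    (hπ : Function.Surjective π) (hker : IsNilpotent (RingHom.ker π)) (l : L →+* Q) (g : S →+* k)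
    (h : ∀ x, π (l x) = g (b x)) :
    ∃ G : S →+* Q, (∀ x, π (G x) = g x) ∧ ∀ x, G (b x) = l x := by
  let := b.toAlgebra
  let := l.toAlgebra
  let := (π.comp l).toAlgebra
  have : Algebra.FormallySmooth L S := hb
  let π' : Q →ₐ[L] k := { π with commutes' := fun _ => rfl }
  let g' : S →ₐ[L] k := { g with commutes' := fun x => (h x).symm }
  let G := Algebra.FormallySmooth.liftOfSurjective g' π' hπ hker
  exact ⟨G.toRingHom, Algebra.FormallySmooth.liftOfSurjective_apply g' π' hπ hker, G.commutes⟩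

lemma LaurentRing.ringHom_ext {k Q : Type*} [CommRing k] [CommRing Q] {d : ℕ}
    {f g : LaurentRing k d →+* Q}
    (h : ∀ r, f (algebraMap k (LaurentRing k d) r) = g (algebraMap k (LaurentRing k d) r))
    (hX : ∀ i, f (LaurentRing.X i) = g (LaurentRing.X i)) : f = g := by
  refine AddMonoidAlgebra.ringHom_ext h fun m => ?_
  let F (f : LaurentRing k d →+* Q) : (Fin d → ℤ) →+ Additive Q :=
    MonoidHom.toAdditiveRight ((f : LaurentRing k d →* Q).comp (AddMonoidAlgebra.of k (Fin d → ℤ)))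
  have key : F f = F g := by
    refine AddMonoidHom.functions_ext _ _ _ fun i x => ?_
    have : (F f).comp (AddMonoidHom.single (fun _ : Fin d => ℤ) i) =
        (F g).comp (AddMonoidHom.single (fun _ : Fin d => ℤ) i) :=
      AddMonoidHom.ext_int (hX i)
    exact DFunLike.congr_fun this x
  exact DFunLike.congr_fun key m

lemma LaurentRing.exists_lift {k Q : Type*} [CommRing k] [CommRing Q] {d : ℕ} (f : k →+* Q)
    (u : Fin d → Qˣ) : ∃ F : LaurentRing k d →+* Q,
      (∀ r, F (algebraMap k (LaurentRing k d) r) = f r) ∧ ∀ i, F (LaurentRing.X i) = u i := by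
  let g : Multiplicative (Fin d → ℤ) →* Q :=
    (Units.coeHom Q).comp
      { toFun := fun m => ∏ i, u i ^ (m.toAdd i)
        map_one' := by simp
        map_mul' := fun x y => by simp [zpow_add, Finset.prod_mul_distrib] }
  refine ⟨AddMonoidAlgebra.liftNCRingHom f g fun _ _ => Commute.all _ _, fun r => ?_, fun i => ?_⟩
  · change AddMonoidAlgebra.liftNC (f : k →+ Q) g (AddMonoidAlgebra.single 0 r) = _
    rw [AddMonoidAlgebra.liftNC_single]
    change f r * g 1 = _
    rw [map_one, mul_one]
  · change AddMonoidAlgebra.liftNC (f : k →+ Q) g (AddMonoidAlgebra.single (Pi.single i 1) 1) = _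
    rw [AddMonoidAlgebra.liftNC_single]
    change f 1 * ((∏ j, u j ^ (Pi.single i (1 : ℤ) : Fin d → ℤ) j : Qˣ) : Q) = _
    rw [map_one, one_mul, Finset.prod_eq_single i]
    · simp
    · intro j _ hj
      simp [hj]
    · simp

end Lifting

/-- Coordinates on an `A`-algebra `R`: lifts `T` of the variables of an étale chart on `R / p`. -/
def IsCoordinates (p : ℕ) (A : Type*) {R : Type*} [CommRing A] [CommRing R] [Algebra A R] {d : ℕ}
    (T : Fin d → R) : Prop :=
  ∃ box : LaurentRing (A ⧸ pIdeal p A) d →ₐ[A] R ⧸ pIdeal p R, box.toRingHom.Etale ∧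
    ∀ i, Ideal.Quotient.mk (pIdeal p R) (T i) = box (LaurentRing.X i)

/-! ### Derivations modulo `p` as maps to dual numbers -/

namespace IsCoordinates

variable {p : ℕ} {A R : Type*} [CommRing A] [CommRing R] [Algebra A R] {d : ℕ} {T : Fin d → R}

lemma ker_fst_nilpotent (k : Type*) [CommRing k] :
    IsNilpotent (RingHom.ker (TrivSqZeroExt.fstHom k k k).toRingHom) := by
  refine ⟨2, (pow_two (RingHom.ker (TrivSqZeroExt.fstHom k k k).toRingHom)).trans ?_⟩
  rw [Ideal.zero_eq_bot, ← le_bot_iff, Ideal.mul_le]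
  intro x hx y hy
  have hx' : x.fst = 0 := hx
  have hy' : y.fst = 0 := hy
  rw [Ideal.mem_bot]
  ext <;> simp [hx', hy']

lemma box_algebraMap (box : LaurentRing (A ⧸ pIdeal p A) d →ₐ[A] R ⧸ pIdeal p R) (a : A) :
    box.toRingHom (algebraMap (A ⧸ pIdeal p A) _ (Ideal.Quotient.mk _ a)) =
      Ideal.Quotient.mk _ (algebraMap A R a) :=
  box.commutes a

/-- An `A`-derivation of `R` into a ring of characteristic `p` is determined by its values on the
`T_i`: both maps factor through `R / p`, which is unramified over the Laurent ring. -/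
lemma dualNumber_ext (hT : IsCoordinates p A T) {k : Type*} [CommRing k] (hk : (p : k) = 0)
    {G G' : R →+* TrivSqZeroExt k k} (h : ∀ x, (G x).fst = (G' x).fst)
    (hA : ∀ a, G (algebraMap A R a) = G' (algebraMap A R a)) (hG : ∀ i, G (T i) = G' (T i)) :
    G = G' := by
  obtain ⟨box, hbox, hX⟩ := hT
  have hp : (p : TrivSqZeroExt k k) = 0 := by
    ext <;> simp [hk]
  have hker (G : R →+* TrivSqZeroExt k k) : ∀ x ∈ pIdeal p R, G x = 0 := fun x hx => by
    obtain ⟨y, rfl⟩ := mem_pIdeal.1 hx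
    rw [map_mul, map_natCast, hp, zero_mul]
  have key : Ideal.Quotient.lift _ G (hker G) = Ideal.Quotient.lift _ G' (hker G') := by
    refine hbox.formallyUnramified.eq_of_comp_eq (TrivSqZeroExt.fstHom k k k).toRingHom
      (ker_fst_nilpotent k) (fun x => ?_) fun x => ?_
    · obtain ⟨x, rfl⟩ := Ideal.Quotient.mk_surjective x
      exact h x
    · refine DFunLike.congr_fun (f := (Ideal.Quotient.lift _ G (hker G)).comp box.toRingHom)
        (g := (Ideal.Quotient.lift _ G' (hker G')).comp box.toRingHom)
        (LaurentRing.ringHom_ext (fun r => ?_) fun i => ?_) x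
      · obtain ⟨a, rfl⟩ := Ideal.Quotient.mk_surjective r
        rw [RingHom.comp_apply, RingHom.comp_apply, box_algebraMap]
        exact hA a
      · have := hX i
        change Ideal.Quotient.lift _ G (hker G) (box (LaurentRing.X i)) =
          Ideal.Quotient.lift _ G' (hker G') (box (LaurentRing.X i))
        rw [← this]
        exact hG i
  ext1 x
  exact DFunLike.congr_fun key (Ideal.Quotient.mk _ x)

/-- An `A`-derivation over `g` may take arbitrary values on the `T_i`: prescribe it on the Laurent
ring and extend along the étale chart by formal smoothness. -/
lemma exists_dualNumber (hT : IsCoordinates p A T) {k : Type*} [CommRing k] (hk : (p : k) = 0)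
    (g : R →+* k) (c : Fin d → k) : ∃ G : R →+* TrivSqZeroExt k k, (∀ x, (G x).fst = g x) ∧
      (∀ a, (G (algebraMap A R a)).snd = 0) ∧ ∀ i, (G (T i)).snd = c i := by
  obtain ⟨box, hbox, hX⟩ := hT
  have hker : ∀ x ∈ pIdeal p R, g x = 0 := fun x hx => by
    obtain ⟨y, rfl⟩ := mem_pIdeal.1 hx
    rw [map_mul, map_natCast, hk, zero_mul]
  have hkerA : ∀ x ∈ pIdeal p A, (g.comp (algebraMap A R)) x = 0 := fun x hx => by
    obtain ⟨y, rfl⟩ := mem_pIdeal.1 hx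
    rw [map_mul, map_natCast, hk, zero_mul]
  let g₀ := Ideal.Quotient.lift _ g hker
  -- The Laurent variables are invertible, so their images must be units; in the dual numbers this
  -- depends only on the first component.
  have hu (i : Fin d) : IsUnit (TrivSqZeroExt.inl (g (T i)) + TrivSqZeroExt.inr (c i)) := by
    rw [TrivSqZeroExt.isUnit_iff_isUnit_fst]
    have h1 : IsUnit (LaurentRing.X i : LaurentRing (A ⧸ pIdeal p A) d) := by
      refine IsUnit.of_mul_eq_one (AddMonoidAlgebra.single (-Pi.single i 1) 1) ?_
      rw [LaurentRing.X, AddMonoidAlgebra.single_mul_single, add_neg_cancel, one_mul]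
      rfl
    have h2 := (h1.map box).map g₀
    rw [← hX] at h2
    simpa [g₀] using h2
  obtain ⟨l, hl, hlX⟩ := LaurentRing.exists_lift
    ((TrivSqZeroExt.inlHom k k).comp (Ideal.Quotient.lift _ _ hkerA)) fun i => (hu i).unit
  obtain ⟨G, hG, hGb⟩ := RingHom.FormallySmooth.exists_lift
    (RingHom.etale_iff_formallyUnramified_and_smooth _ |>.1 hbox).2.formallySmooth
    (TrivSqZeroExt.fstHom k k k).toRingHom
    (fun x => ⟨TrivSqZeroExt.inl x, rfl⟩) (ker_fst_nilpotent k) l g₀ (fun x => by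
      refine DFunLike.congr_fun (f := (TrivSqZeroExt.fstHom k k k).toRingHom.comp l)
        (g := g₀.comp box.toRingHom) (LaurentRing.ringHom_ext (fun r => ?_) fun i => ?_) x
      · obtain ⟨a, rfl⟩ := Ideal.Quotient.mk_surjective r
        rw [RingHom.comp_apply, RingHom.comp_apply, box_algebraMap, hl]
        rfl
      · rw [RingHom.comp_apply, hlX]
        change _ = g₀ (box (LaurentRing.X i))
        rw [← hX]
        simp [g₀])
  refine ⟨G.comp (Ideal.Quotient.mk _), fun x => hG _, fun a => ?_, fun i => ?_⟩
  · rw [RingHom.comp_apply, ← box_algebraMap box, hGb, hl]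
    rfl
  · rw [RingHom.comp_apply, hX]
    change (G (box.toRingHom (LaurentRing.X i))).snd = _
    rw [hGb, hlX]
    simp

end IsCoordinates

/-! ### Maps out of `R` with prescribed values on coordinates -/

namespace IsCoordinates

variable {p : ℕ} {A R B : Type*} [CommRing A] [CommRing R] [CommRing B] [Algebra A R] {d : ℕ}
  {T : Fin d → R}

/-- A ring map to `k` and a derivation to `k` over it give a ring map to the dual numbers. -/
lemma _root_.TrivSqZeroExt.exists_ringHom {R k : Type*} [CommRing R] [CommRing k] (g : R →+* k)
    (D : R → k) (hadd : ∀ x y, D (x + y) = D x + D y)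
    (hmul : ∀ x y, D (x * y) = g x * D y + g y * D x) :
    ∃ G : R →+* TrivSqZeroExt k k,
      ∀ x, G x = TrivSqZeroExt.inl (g x) + TrivSqZeroExt.inr (D x) := by
  have h0 : D 0 = 0 := by simpa using hadd 0 0
  have h1 : D 1 = 0 := by simpa using hmul 1 1
  refine ⟨⟨⟨⟨fun x => TrivSqZeroExt.inl (g x) + TrivSqZeroExt.inr (D x), ?_⟩, fun x y => ?_⟩, ?_,
    fun x y => ?_⟩, fun x => rfl⟩
  · simp [h1]
  · ext
    · simp
    · simp [hmul, mul_comm]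
  · simp [h0]
  · ext <;> simp [hadd]

/-- Two maps on `R` that agree modulo `p`, on `A` and on coordinates are equal. -/
lemma ringHom_ext (hT : IsCoordinates p A T) (hB : IsCrystalline p B) {f g : R →+* B}
    (hA : ∀ a, f (algebraMap A R a) = g (algebraMap A R a)) (hfg : ∀ x, (p : B) ∣ f x - g x)
    (h : ∀ i, f (T i) = g (T i)) : f = g := by
  have key (n : ℕ) : ∀ x, (p : B) ^ (n + 1) ∣ f x - g x := by
    induction n with
    | zero => simpa using hfg
    | succ n ih =>
      -- `D = (f - g) / p^(n+1)` is additive and satisfies a Leibniz rule twisted by `f` and `g`. As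
      -- `f ≡ g` mod `p`, it reduces to an honest derivation mod `p`, which kills `A` and the `T_i`
      -- and therefore vanishes.
      choose D hD using ih
      obtain ⟨G, hG⟩ := TrivSqZeroExt.exists_ringHom ((Ideal.Quotient.mk (pIdeal p B)).comp f)
        (fun x => Ideal.Quotient.mk (pIdeal p B) (D x))
        (fun x y => by
          rw [← map_add]
          congr 1
          refine hB.cancel_pow (n + 1) ?_
          rw [← hD, mul_add, ← hD, ← hD, map_add, map_add]
          ring)
        (fun x y => by
          have h1 : D (x * y) = f x * D y + g y * D x := by
            refine hB.cancel_pow (n + 1) ?_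
            rw [← hD, map_mul, map_mul]
            linear_combination f x * hD y + g y * hD x
          rw [h1, map_add, map_mul, map_mul, ← mk_pIdeal_eq.2 (hfg y)]
          rfl)
      have hz {x} (hx : f x = g x) : D x = 0 :=
        hB.cancel_pow (n + 1) (by rw [← hD, hx, sub_self, mul_zero])
      have hG' : G = (TrivSqZeroExt.inlHom _ _).comp ((Ideal.Quotient.mk (pIdeal p B)).comp f) := by
        refine hT.dualNumber_ext (by rw [← map_natCast (Ideal.Quotient.mk (pIdeal p B)),
          Ideal.Quotient.eq_zero_iff_mem, mem_pIdeal]) (fun x => ?_) (fun a => ?_) fun i => ?_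
        · simp [hG]
        · simp [hG, hz (hA a)]
        · simp [hG, hz (h i)]
      intro x
      have h1 : (G x).snd = 0 := by simp [hG']
      rw [hG, TrivSqZeroExt.snd_add, TrivSqZeroExt.snd_inl, TrivSqZeroExt.snd_inr, zero_add,
        Ideal.Quotient.eq_zero_iff_mem, mem_pIdeal] at h1
      rw [hD, pow_succ]
      exact mul_dvd_mul_left _ h1
  ext x
  refine hB.eq_of_forall fun n => (pow_dvd_pow _ n.le_succ).trans (key n x)

/-- Smoothness gives some lift `G` of `F` modulo `p^(n+2)`. Its error on `T_i` is `p^(n+1) c_i`, and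
adding `p^(n+1) D` for a derivation `D` mod `p` with `D(T_i) = c_i` removes it. -/
lemma exists_lift_step (hT : IsCoordinates p A T) (hR : IsPCompletelySmooth p A R)
    (f₀ : R →+* B) (b : Fin d → B) (n : ℕ) (F : R →+* B ⧸ pIdeal p B ^ (n + 1))
    (hA : ∀ a, F (algebraMap A R a) = Ideal.Quotient.mk _ (f₀ (algebraMap A R a)))
    (hF : ∀ x y, F x = Ideal.Quotient.mk _ y → (p : B) ∣ y - f₀ x)
    (hFT : ∀ i, F (T i) = Ideal.Quotient.mk _ (b i)) :
    ∃ F' : R →+* B ⧸ pIdeal p B ^ (n + 2),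
      (∀ a, F' (algebraMap A R a) = Ideal.Quotient.mk _ (f₀ (algebraMap A R a))) ∧
      (∀ i, F' (T i) = Ideal.Quotient.mk _ (b i)) ∧
      (Ideal.Quotient.factorPow (pIdeal p B) (n + 1).le_succ).comp F' = F := by
  let π := Ideal.Quotient.factorPow (pIdeal p B) (n + 1).le_succ
  have hπ (x : B) : π (Ideal.Quotient.mk _ x) = Ideal.Quotient.mk _ x := rfl
  have hker : IsNilpotent (RingHom.ker π) := by
    refine ⟨2, (pow_two (RingHom.ker π)).trans ?_⟩
    rw [Ideal.zero_eq_bot, ← le_bot_iff, Ideal.mul_le]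
    intro x hx y hy
    obtain ⟨x, rfl⟩ := Ideal.Quotient.mk_surjective x
    obtain ⟨y, rfl⟩ := Ideal.Quotient.mk_surjective y
    rw [RingHom.mem_ker, hπ, Ideal.Quotient.eq_zero_iff_mem, mem_pIdeal_pow] at hx hy
    rw [Ideal.mem_bot, ← map_mul, Ideal.Quotient.eq_zero_iff_mem, mem_pIdeal_pow]
    refine (pow_dvd_pow _ ?_).trans ((pow_add (p : B) (n + 1) (n + 1)).symm ▸ mul_dvd_mul hx hy)
    omega
  have hFker : ∀ x ∈ pIdeal p R ^ (n + 2), F x = 0 := fun x hx => by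
    obtain ⟨y, rfl⟩ := mem_pIdeal_pow.1 hx
    rw [map_mul, map_pow, map_natCast, ← map_natCast (Ideal.Quotient.mk (pIdeal p B ^ (n + 1))),
      ← map_pow, Ideal.Quotient.eq_zero_iff_mem.2 (mem_pIdeal_pow.2 (pow_dvd_pow _ (n + 1).le_succ)),
      zero_mul]
  obtain ⟨G, hG, hGA⟩ := RingHom.FormallySmooth.exists_lift
    (hR.smooth (n + 2)).formallySmooth π
    (fun x => by
      obtain ⟨x, rfl⟩ := Ideal.Quotient.mk_surjective x
      exact ⟨Ideal.Quotient.mk _ x, rfl⟩) hker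
    (reductionPow p (f₀.comp (algebraMap A R)) (n + 2)) (Ideal.Quotient.lift _ F hFker)
    (fun x => by
      obtain ⟨x, rfl⟩ := Ideal.Quotient.mk_surjective x
      exact (hA x).symm)
  -- Here `h` and, below, `D` are mere functions of representatives in `B`; their ring and
  -- derivation laws hold only modulo `p^(n+2)` and `p`. The latter suffices, since `D` is
  -- multiplied by `p^(n+1)`.
  choose h hh using fun x => Ideal.Quotient.mk_surjective (G (Ideal.Quotient.mk _ x))
  have hhF (x) : F x = Ideal.Quotient.mk _ (h x) := by
    rw [← hπ, hh, hG]
    rfl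
  have hhf (x) := hF x (h x) (hhF x)
  have hc (i) : (p : B) ^ (n + 1) ∣ b i - h (T i) := by
    rw [← mk_pIdeal_pow_eq, ← hhF, hFT]
  choose c hc using hc
  obtain ⟨D', hD'f, hD'A, hD'T⟩ := hT.exists_dualNumber (k := B ⧸ pIdeal p B)
    (by rw [← map_natCast (Ideal.Quotient.mk (pIdeal p B)), Ideal.Quotient.eq_zero_iff_mem,
      mem_pIdeal]) ((Ideal.Quotient.mk _).comp f₀) fun i => Ideal.Quotient.mk _ (c i)
  choose D hD using fun x => Ideal.Quotient.mk_surjective ((D' x).snd)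
  have hlift {x y : B} (hxy : Ideal.Quotient.mk (pIdeal p B) x = Ideal.Quotient.mk (pIdeal p B) y) :
      Ideal.Quotient.mk (pIdeal p B ^ (n + 2)) (p ^ (n + 1) * x) =
        Ideal.Quotient.mk _ (p ^ (n + 1) * y) := by
    rw [mk_pIdeal_pow_eq, ← mul_sub, pow_succ (p : B) (n + 1)]
    exact mul_dvd_mul_left _ (mk_pIdeal_eq.1 hxy)
  have hp0 : Ideal.Quotient.mk (pIdeal p B ^ (n + 2)) (p ^ (n + 1) * p ^ (n + 1)) = 0 := by
    rw [← pow_add, Ideal.Quotient.eq_zero_iff_mem, mem_pIdeal_pow]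
    exact pow_dvd_pow _ (by omega)
  have hD1 : Ideal.Quotient.mk (pIdeal p B) (D 1) = Ideal.Quotient.mk (pIdeal p B) 0 := by
    rw [hD, map_one, TrivSqZeroExt.snd_one, map_zero]
  have hD0 : Ideal.Quotient.mk (pIdeal p B) (D 0) = Ideal.Quotient.mk (pIdeal p B) 0 := by
    rw [hD, map_zero, TrivSqZeroExt.snd_zero, map_zero]
  have hDadd (x y) : Ideal.Quotient.mk (pIdeal p B) (D (x + y)) =
      Ideal.Quotient.mk (pIdeal p B) (D x + D y) := by
    rw [hD, map_add, TrivSqZeroExt.snd_add, map_add, hD, hD]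
  have hDmul (x y) : Ideal.Quotient.mk (pIdeal p B) (D (x * y)) =
      Ideal.Quotient.mk (pIdeal p B) (h x * D y + h y * D x) := by
    rw [hD, map_mul, TrivSqZeroExt.snd_mul, map_add, map_mul, map_mul, hD, hD, hD'f, hD'f,
      mk_pIdeal_eq.2 (hhf x), mk_pIdeal_eq.2 (hhf y)]
    simp [mul_comm]
  let F' : R →+* B ⧸ pIdeal p B ^ (n + 2) :=
    { toFun := fun x => Ideal.Quotient.mk _ (h x + p ^ (n + 1) * D x)
      map_one' := by rw [map_add, hlift hD1, hh]; simp
      map_zero' := by rw [map_add, hlift hD0, hh]; simp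
      map_add' := fun x y => by
        rw [map_add, hlift (hDadd x y), hh]
        simp only [map_add, map_mul, hh]
        ring
      map_mul' := fun x y => by
        have e1 : Ideal.Quotient.mk (pIdeal p B ^ (n + 2)) (h (x * y)) =
          Ideal.Quotient.mk _ (h x * h y) := by rw [hh, map_mul, map_mul, map_mul, hh, hh]
        -- The only term left is `p^(2n+2) D(x) D(y)`, which vanishes modulo `p^(n+2)`.
        rw [map_add, hlift (hDmul x y), e1, ← map_add, ← map_mul, ← sub_eq_zero, ← map_sub,
          ← neg_eq_zero, ← map_neg]
        convert congrArg (· * Ideal.Quotient.mk (pIdeal p B ^ (n + 2)) (D x * D y)) hp0 using 1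
        · rw [← map_mul]
          congr 1
          ring
        · rw [zero_mul] }
  have hF' (x) : F' x = Ideal.Quotient.mk _ (h x + p ^ (n + 1) * D x) := rfl
  refine ⟨F', fun a => ?_, fun i => ?_, ?_⟩
  · have : Ideal.Quotient.mk (pIdeal p B) (D (algebraMap A R a)) =
        Ideal.Quotient.mk (pIdeal p B) 0 := by rw [hD, hD'A, map_zero]
    rw [hF', map_add, hlift this, hh, mul_zero, map_zero, add_zero]
    exact hGA (Ideal.Quotient.mk _ a)
  · rw [hF', map_add, hlift ((hD _).trans (hD'T i)), ← map_add]
    congr 1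
    linear_combination -hc i
  · ext x
    change Ideal.Quotient.mk _ (h x + p ^ (n + 1) * D x) = F x
    rw [hhF, mk_pIdeal_pow_eq]
    simp

/-- A map on `R` can be changed within its class modulo `p` to take prescribed values on the
coordinates. -/
lemma exists_lift (hT : IsCoordinates p A T) (hR : IsPCompletelySmooth p A R)
    (hB : IsAdicComplete (pIdeal p B) B) (f₀ : R →+* B) (b : Fin d → B)
    (hb : ∀ i, (p : B) ∣ b i - f₀ (T i)) :
    ∃ f : R →+* B, (∀ a, f (algebraMap A R a) = f₀ (algebraMap A R a)) ∧
      (∀ x, (p : B) ∣ f x - f₀ x) ∧ ∀ i, f (T i) = b i := by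
  -- The tower starts at exponent `1`, so that being congruent to `f₀` mod `p` makes sense at each
  -- stage.
  let X (n : ℕ) := {F : R →+* B ⧸ pIdeal p B ^ (n + 1) //
    (∀ a, F (algebraMap A R a) = Ideal.Quotient.mk _ (f₀ (algebraMap A R a))) ∧
    (∀ x y, F x = Ideal.Quotient.mk _ y → (p : B) ∣ y - f₀ x) ∧
    ∀ i, F (T i) = Ideal.Quotient.mk _ (b i)}
  have step (n : ℕ) (F : X n) : ∃ F' : X (n + 1),
      (Ideal.Quotient.factorPow (pIdeal p B) (n + 1).le_succ).comp F'.1 = F.1 := by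
    obtain ⟨F, hA, hF, hFT⟩ := F
    obtain ⟨F', hA', hFT', hF'⟩ := exists_lift_step hT hR f₀ b n F hA hF hFT
    refine ⟨⟨F', hA', fun x y hxy => hF x y ?_, hFT'⟩, hF'⟩
    rw [← hF', RingHom.comp_apply, hxy]
    rfl
  choose next hnext using step
  let F₀ : X 0 := by
    refine ⟨(Ideal.Quotient.mk _).comp f₀, fun _ => rfl, fun x y hxy => ?_, fun i => ?_⟩
    · have := mk_pIdeal_pow_eq.1 hxy.symm
      simpa using this
    · rw [RingHom.comp_apply, eq_comm, mk_pIdeal_pow_eq]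
      simpa using hb i
  let F (n : ℕ) : X n := Nat.rec F₀ next n
  have hF : ∀ {m}, (Ideal.Quotient.factorPow (pIdeal p B) (m + 1).le_succ).comp (F (m + 1)).1 =
    (F m).1 := fun {m} => hnext m (F m)
  have ha : StrictMono (fun n : ℕ => n + 1) := fun _ _ h => Nat.add_lt_add_right h 1
  let f := IsAdicComplete.StrictMono.liftRingHom (pIdeal p B) ha (fun n => (F n).1) hF
  have hf (n x) : Ideal.Quotient.mk (pIdeal p B ^ (n + 1)) (f x) = (F n).1 x :=
    IsAdicComplete.StrictMono.mk_liftRingHom (pIdeal p B) ha (fun n => (F n).1) hF x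
  refine ⟨f, fun a => ?_, fun x => (F 0).2.2.1 _ _ (hf 0 x).symm, fun i => ?_⟩
  · refine eq_of_forall_pow_dvd_sub (p := p) fun n => (pow_dvd_pow _ n.le_succ).trans ?_
    rw [← mk_pIdeal_pow_eq, hf]
    exact (F n).2.1 a
  · refine eq_of_forall_pow_dvd_sub (p := p) fun n => (pow_dvd_pow _ n.le_succ).trans ?_
    rw [← mk_pIdeal_pow_eq, hf]
    exact (F n).2.2.2 i

end IsCoordinates

/-! ### Elements with divided powers -/

/-- Every power `y ^ n` is divisible by `n!`. -/
def HasDividedPowers {B : Type*} [CommRing B] (y : B) : Prop := ∀ n : ℕ, (n.factorial : B) ∣ y ^ n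

section HasDividedPowers

variable {B : Type*} [CommRing B]

lemma HasDividedPowers.add {x y : B} (hx : HasDividedPowers x) (hy : HasDividedPowers y) :
    HasDividedPowers (x + y) := by
  intro n
  rw [add_pow]
  refine Finset.dvd_sum fun m hm => ?_
  have hm' : m ≤ n := Nat.lt_succ_iff.1 (Finset.mem_range.1 hm)
  rw [← Nat.choose_mul_factorial_mul_factorial hm', Nat.cast_mul, Nat.cast_mul, mul_assoc,
    mul_comm]
  exact mul_dvd_mul (mul_dvd_mul (hx _) (hy _)) dvd_rfl

lemma HasDividedPowers.mul_left {y : B} (hy : HasDividedPowers y) (x : B) :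
    HasDividedPowers (x * y) := fun n => by
  rw [mul_pow]
  exact (hy n).mul_left _

lemma hasDividedPowers_zero : HasDividedPowers (0 : B) := fun n => by
  cases n <;> simp

lemma HasDividedPowers.sum {ι : Type*} (s : Finset ι) (y : ι → B)
    (hy : ∀ i, HasDividedPowers (y i)) : HasDividedPowers (∑ i ∈ s, y i) := by
  classical
  induction s using Finset.induction_on with
  | empty => simpa using hasDividedPowers_zero
  | insert i s hi ih =>
    rw [Finset.sum_insert hi]
    exact (hy i).add ih

variable {p : ℕ} [Fact p.Prime]

namespace IsCrystalline

variable (hB : IsCrystalline p B)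
include hB

lemma factorial_cancel (n : ℕ) {x y : B} (h : (n.factorial : B) * x = n.factorial * y) : x = y :=
  hB.natCast_cancel n.factorial_ne_zero h

lemma hasDividedPowers_of_dvd {y : B} (hy : (p : B) ∣ y) : HasDividedPowers y := by
  obtain ⟨w, rfl⟩ := hy
  rw [mul_comm]
  refine HasDividedPowers.mul_left (fun n => ?_) w
  rw [hB.natCast_dvd_iff n.factorial_ne_zero]
  exact pow_dvd_pow _ (padicValNat_factorial_le (p := p) n)

/-- The inequality `v_p(n!) < n` is strict for `n ≠ 0`, which leaves one spare factor `p` in `y^n /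
n!`. -/
lemma dvd_of_factorial_mul_eq_pow {y z : B} (hy : (p : B) ∣ y) {n : ℕ} (hn : n ≠ 0)
    (h : (n.factorial : B) * z = y ^ n) : (p : B) ∣ z := by
  obtain ⟨w, rfl⟩ := hy
  obtain ⟨u, hu, hn'⟩ := hB.natCast_eq_pow_mul_isUnit n.factorial_ne_zero
  obtain ⟨k, hk⟩ := Nat.exists_eq_add_of_lt (padicValNat_factorial_lt_of_ne_zero p hn)
  have h2 : u * z = p * (p ^ k * w ^ n) := by
    refine hB.cancel_pow (padicValNat p n.factorial) ?_
    rw [← mul_assoc, ← hn', h, mul_pow]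
    have : (p : B) ^ n = p ^ padicValNat p n.factorial * p ^ k * p := by
      rw [← pow_add, ← pow_succ, ← hk]
    rw [this]
    ring
  exact hu.dvd_mul_left.1 (Dvd.intro _ h2.symm)

/-- In a `p`-torsion free `δ`-ring, an element whose `p`-th power is divisible by `p` has divided
powers. -/
lemma hasDividedPowers_of_dvd_pow (δ : DeltaStructure p B) {y : B} (hy : (p : B) ∣ y ^ p) :
    HasDividedPowers y := by
  have hp := (Fact.out : p.Prime)
  intro n
  induction n using Nat.strong_induction_on generalizing y with
  | _ n ih =>
    rcases Nat.eq_zero_or_pos n with rfl | hn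
    · simp
    obtain ⟨w, hw⟩ := hy
    have hφ : δ.frobeniusHom y = p * (w + δ y) := by
      rw [δ.frobeniusHom_apply, hw, mul_add]
    -- Applying `φ` to `y^p = p w` gives `p φ(w) = φ(y)^p`, divisible by `p^p`; since `p - 1 ≥ 1`,
    -- also `p ∣ φ(w)`. So `w` satisfies the hypothesis on `y` and the induction can descend from
    -- `n` to `n / p`.
    have hφw : (p : B) ∣ δ.frobeniusHom w := by
      have h1 : (p : B) * δ.frobeniusHom w = p * (p ^ (p - 1) * (w + δ y) ^ p) := by
        rw [← mul_assoc, ← pow_succ', Nat.sub_add_cancel hp.one_le, ← mul_pow, ← hφ, ← map_pow, hw,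
          map_mul, map_natCast]
      rw [hB.cancel h1]
      exact (dvd_pow_self _ (Nat.sub_ne_zero_of_lt hp.one_lt)).mul_right _
    have hww : (p : B) ∣ w ^ p := (dvd_sub_right hφw).1 (δ.dvd_frobeniusHom_sub w)
    have h := ih (n / p) (Nat.div_lt_self hn hp.one_lt) hww
    rw [hB.natCast_dvd_iff (Nat.factorial_ne_zero _)] at h ⊢
    -- Legendre's recursion matches `y^n = p^(n/p) w^(n/p) y^(n mod p)`.
    have hv : padicValNat p n.factorial = n / p + padicValNat p (n / p).factorial := by
      conv_lhs => rw [← Nat.div_add_mod n p]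
      rw [padicValNat_factorial_mul_add _ (Nat.mod_lt _ hp.pos), padicValNat_factorial_mul,
        add_comm]
    rw [hv]
    conv_rhs => rw [← Nat.div_add_mod n p, pow_add, pow_mul, hw, mul_pow]
    rw [pow_add]
    exact (mul_dvd_mul_left _ h).mul_right _

end IsCrystalline

end HasDividedPowers

/-! ### Completed divided power polynomials -/

section PdPolynomial

open Finset in
/-- A map from the coefficients and elements with divided powers give a map on the divided power
algebra. -/
lemma DividedPowerAlgebra.exists_lift {R B : Type*} [CommRing R] [CommRing B] {d : ℕ}
    (hB : ∀ n : ℕ, n ≠ 0 → ∀ x y : B, n * x = n * y → x = y) (g : R →+* B) (y : Fin d → B)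
    (hy : ∀ i, HasDividedPowers (y i)) :
    ∃ F : DividedPowerAlgebra R (Fin d → R) →+* B, (∀ r, F (algebraMap R _ r) = g r) ∧
      ∀ i, F (DividedPowerAlgebra.dp R 1 (Pi.single i 1)) = y i := by
  let := g.toAlgebra
  let l : (Fin d → R) →ₗ[R] B := Fintype.linearCombination R y
  have hl (m) : HasDividedPowers (l m) := by
    simp only [l, Fintype.linearCombination_apply, Algebra.smul_def]
    exact .sum _ _ fun i => (hy i).mul_left _
  choose γ hγ using hl
  let f : ℕ × (Fin d → R) → B := fun x => γ x.2 x.1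
  have hf (n m) : (n.factorial : B) * f (n, m) = l m ^ n := (hγ m n).symm
  have hchoose (n k : ℕ) : ((n + k).factorial : B) =
      (n + k).choose n * n.factorial * k.factorial := by
    rw [← Nat.add_choose_mul_factorial_mul_factorial, ← Nat.choose_symm_add]
    push_cast
    ring
  refine ⟨(DividedPowerAlgebra.lift' (f := f) (fun m => ?_) (fun n r m => ?_) (fun n k m => ?_)
    fun n u v => ?_).toRingHom, AlgHom.commutes _, fun i => ?_⟩
  · simpa using hf 0 m
  · refine hB _ n.factorial_ne_zero _ _ ?_
    rw [hf, map_smul, Algebra.smul_def, mul_pow, ← hf, Algebra.smul_def, map_pow]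
    ring
  · refine hB _ (mul_ne_zero n.factorial_ne_zero k.factorial_ne_zero) _ _ ?_
    calc _ = (n.factorial * f (n, m)) * (k.factorial * f (k, m)) := by push_cast; ring
      _ = (n + k).factorial * f (n + k, m) := by rw [hf, hf, hf, pow_add]
      _ = _ := by
        rw [hchoose, nsmul_eq_mul]
        push_cast
        ring
  · refine hB _ n.factorial_ne_zero _ _ ?_
    rw [hf, map_add, (Commute.all _ _).add_pow', mul_sum]
    refine sum_congr rfl fun x hx => ?_
    obtain rfl := mem_antidiagonal.1 hx
    rw [← hf, ← hf, hchoose, nsmul_eq_mul]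
    ring
  · change DividedPowerAlgebra.lift' _ _ _ _ _ = _
    rw [DividedPowerAlgebra.lift'_apply_dp]
    simpa [l, Fintype.linearCombination_apply, Pi.single_apply] using hf 1 (Pi.single i 1)

variable {p : ℕ} [Fact p.Prime] {R : Type u} [CommRing R] {d : ℕ}

open MvPolynomial in
-- Over the total fraction ring `K` the nonzero integers are invertible, so `γ_n(e_i) ↦ X_i^n / n!`
-- maps to `K[X]`. The divided monomials span and go to distinct monomials with unit coefficients,
-- so coefficients over `R` can be compared.
lemma DividedPowerAlgebra.torsionFree (hR : IsCrystalline p R)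
    (x : DividedPowerAlgebra R (Fin d → R)) (hx : (p : DividedPowerAlgebra R (Fin d → R)) * x = 0) :
    x = 0 := by
  let K := FractionRing R
  have hK (n : ℕ) (hn : n ≠ 0) : IsUnit (n : K) := by
    rw [← map_natCast (algebraMap R K)]
    refine IsLocalization.map_units K ⟨(n : R), mem_nonZeroDivisors_iff_right.2 fun z hz => ?_⟩
    exact hR.natCast_cancel hn (by rw [mul_comm, hz, mul_zero])
  have hKX (n : ℕ) (hn : n ≠ 0) : IsUnit (n : MvPolynomial (Fin d) K) := by
    rw [← map_natCast C]
    exact (hK n hn).map C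
  obtain ⟨F, hFR, hFX⟩ := DividedPowerAlgebra.exists_lift (R := R)
    (fun n hn x y h => (hKX n hn).mul_left_cancel h)
    (C.comp (algebraMap R K)) (X : Fin d → MvPolynomial (Fin d) K)
    fun i n => (hKX _ n.factorial_ne_zero).dvd
  let w (n : ℕ) : Kˣ := (hK _ n.factorial_ne_zero).unit⁻¹
  have hFdp (i : Fin d) (n : ℕ) :
      F (DividedPowerAlgebra.dp R n (Pi.single i 1)) = C (w n : K) * X i ^ n := by
    refine (hKX _ n.factorial_ne_zero).mul_left_cancel ?_
    rw [← mul_assoc, ← map_natCast C, ← map_mul, (hK _ n.factorial_ne_zero).mul_val_inv, map_one,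
      one_mul, map_natCast, ← map_natCast F, ← map_mul, DividedPowerAlgebra.natFactorial_mul_dp_eq,
      map_pow, hFX]
  have hspan := DividedPowerAlgebra.submodule_span_prod_dp_eq_top (R := R) (M := Fin d → R)
    (v := fun i => Pi.single i 1) (by
      rw [← (Pi.basisFun R (Fin d)).span_eq]
      congr 2
      ext1 i
      exact (Pi.basisFun_apply R (Fin d) i).symm)
  have hx' : x ∈ Submodule.span R _ := hspan ▸ Submodule.mem_top
  obtain ⟨c, rfl⟩ := (Finsupp.mem_span_range_iff_exists_finsupp).1 hx'
  have hFc : F (c.sum fun n a => a • n.prod fun i k => DividedPowerAlgebra.dp R k (Pi.single i 1)) =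
      c.sum fun n a => monomial n (algebraMap R K a * (n.prod fun _ k => w k : Kˣ)) := by
    rw [map_finsuppSum]
    refine Finsupp.sum_congr fun n _ => ?_
    rw [Algebra.smul_def, map_mul, hFR, map_finsuppProd]
    simp only [hFdp]
    rw [Finsupp.prod_mul, monomial_eq, map_mul, mul_assoc]
    simp [Finsupp.prod]
  have hzero : c = 0 := by
    ext m
    have h1 := congrArg (coeff m) (congrArg F hx)
    rw [map_mul, hFc, map_natCast, map_zero, ← map_natCast C, coeff_C_mul, coeff_zero,
      Finsupp.sum, coeff_sum] at h1
    simp only [coeff_monomial] at h1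
    rw [Finset.sum_ite_eq'] at h1
    split_ifs at h1 with hm
    · rw [← mul_assoc, Units.mul_left_eq_zero, ← map_natCast (algebraMap R K), ← map_mul] at h1
      exact hR.torsionFree _ (IsFractionRing.injective R K (h1.trans (map_zero _).symm))
    · simpa using hm
  rw [hzero, Finsupp.sum_zero_index]

namespace PdPolynomial

lemma isCrystalline (hR : IsCrystalline p R) : IsCrystalline p (PdPolynomial p R d) :=
  PCompletion.isCrystalline fun n x ⟨y, hy⟩ => ⟨y, by
    rw [← sub_eq_zero]
    refine DividedPowerAlgebra.torsionFree hR _ ?_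
    rw [mul_sub, hy]
    ring⟩

lemma exists_lift {B : Type*} [CommRing B] (hB : IsCrystalline p B) (g : R →+* B) (y : Fin d → B)
    (hy : ∀ i, HasDividedPowers (y i)) :
    ∃ F : PdPolynomial p R d →+* B, (∀ r, F (algebraMap R _ r) = g r) ∧ ∀ i, F (Y i) = y i := by
  obtain ⟨F₀, h1, h2⟩ := DividedPowerAlgebra.exists_lift
    (fun n hn x y h => hB.natCast_cancel hn h) g y hy
  obtain ⟨F, hF⟩ := PCompletion.exists_lift hB.complete F₀
  exact ⟨F, fun r => (hF _).trans (h1 r), fun i => (hF _).trans (h2 i)⟩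

omit [Fact p.Prime] in
lemma algebraMap_dp_one (m : Fin d → R) :
    algebraMap (DividedPowerAlgebra R (Fin d → R)) (PdPolynomial p R d)
      (DividedPowerAlgebra.dp R 1 m) = ∑ i, algebraMap R _ (m i) * Y i := by
  have h : DividedPowerAlgebra.dp R 1 m =
      ∑ i, algebraMap R _ (m i) * DividedPowerAlgebra.dp R 1 (Pi.single i 1) := by
    simp only [← DividedPowerAlgebra.embed_def, ← Algebra.smul_def, ← map_smul, ← map_sum]
    congr 1
    ext j
    simp [Finset.sum_apply, Pi.single_apply]
  rw [h, map_sum]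
  simp only [map_mul]
  rfl

omit [Fact p.Prime] in
lemma factorial_mul_algebraMap_dp (n : ℕ) (m : Fin d → R) :
    (n.factorial : PdPolynomial p R d) * algebraMap (DividedPowerAlgebra R (Fin d → R)) _
      (DividedPowerAlgebra.dp R n m) = (∑ i, algebraMap R _ (m i) * Y i) ^ n := by
  rw [← algebraMap_dp_one, ← map_pow, ← DividedPowerAlgebra.natFactorial_mul_dp_eq, map_mul,
    map_natCast]

/-- Factorials cancel in `B`, so values on `γ_n(m)` are forced by `n! γ_n(m) = m^n`; density handles
the completion. -/
lemma ringHom_ext {B : Type*} [CommRing B] (hB : IsCrystalline p B)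
    {F G : PdPolynomial p R d →+* B} (hR : ∀ r, F (algebraMap R _ r) = G (algebraMap R _ r))
    (hY : ∀ i, F (Y i) = G (Y i)) : F = G := by
  have := hB.complete
  refine PCompletion.ringHom_ext fun x => ?_
  induction x using DividedPowerAlgebra.induction_on with
  | C r => exact hR r
  | add x y hx hy => rw [map_add, map_add, map_add, hx, hy]
  | dp x n m hx =>
    rw [map_mul, map_mul, map_mul, hx]
    congr 1
    refine hB.factorial_cancel n ?_
    have h := factorial_mul_algebraMap_dp (p := p) n m
    have hF := congrArg F h
    have hG := congrArg G h
    rw [map_mul, map_natCast] at hF hG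
    rw [hF, hG]
    simp only [map_pow, map_sum, map_mul, hR, hY]

/-- `γ_n(m)^p` is `(pn)! / (n!)^p` times `γ_{pn}(m)`, and this integer is a multiple of `p!`. -/
lemma dvd_algebraMap_dp_pow {n : ℕ} (hn : n ≠ 0) (m : Fin d → R) :
    (p : PdPolynomial p R d) ∣ algebraMap (DividedPowerAlgebra R (Fin d → R)) _
      (DividedPowerAlgebra.dp R n m) ^ p := by
  have h : p ∣ Multiset.multinomial (p • {n}) := by
    rw [Multiset.multinomial_nsmul_singleton]
    have h1 := Nat.uniformBell_mul_eq p hn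
    have h2 : (p * n).factorial / n.factorial ^ p = p.uniformBell n * p.factorial := by
      rw [← h1, mul_right_comm]
      exact Nat.mul_div_cancel _ (pow_pos n.factorial_pos _)
    rw [Nat.multinomial, Finset.prod_const, Finset.sum_const, Finset.card_range, smul_eq_mul, h2]
    exact (Nat.dvd_factorial (Fact.out : p.Prime).pos le_rfl).mul_left _
  obtain ⟨k, hk⟩ := h
  rw [← map_pow, DividedPowerAlgebra.pow_dp, hk, map_mul, map_natCast, Nat.cast_mul, mul_assoc]
  exact dvd_mul_right _ _

/-- An endomorphism that lifts the Frobenius on coefficients and sends the variables into `(p)` is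
a Frobenius lift. -/
lemma dvd_sub_pow (hR : IsCrystalline p R) (F : PdPolynomial p R d →+* PdPolynomial p R d)
    (hFR : ∀ r, (p : PdPolynomial p R d) ∣ F (algebraMap R _ r) - algebraMap R _ r ^ p)
    (hFY : ∀ i, (p : PdPolynomial p R d) ∣ F (Y i)) (c : PdPolynomial p R d) :
    (p : PdPolynomial p R d) ∣ F c - c ^ p := by
  refine PCompletion.dvd_map_sub_pow F (fun x => ?_) c
  induction x using DividedPowerAlgebra.induction_on with
  | C r => exact hFR r
  | add x y hx hy => rw [map_add]; exact dvd_map_sub_pow_add hx hy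
  | dp x n m hx =>
    rw [map_mul]
    refine dvd_map_sub_pow_mul hx ?_
    rcases eq_or_ne n 0 with rfl | hn
    · simp [DividedPowerAlgebra.dp_zero]
    · refine dvd_sub ?_ (dvd_algebraMap_dp_pow hn m)
      refine (isCrystalline hR).dvd_of_factorial_mul_eq_pow (n := n)
        (y := F (∑ i, algebraMap R _ (m i) * Y i)) ?_ hn ?_
      · rw [map_sum]
        refine Finset.dvd_sum fun i _ => ?_
        rw [map_mul]
        exact (hFY i).mul_left _
      · rw [← map_natCast F, ← map_mul, factorial_mul_algebraMap_dp, map_pow]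

end PdPolynomial

end PdPolynomial


/-! ### The completed tensor product -/

namespace CompletedTensor

variable {p : ℕ} {A R : Type u} [CommRing A] [CommRing R] [Algebra A R]

/-- The tensor square of `R / p^m` is flat over `A / p^m`, where every element killed by `p` is a
multiple of `p^(m-1)`. With `m = n + 1` this transfers to `R ⊗[A] R` modulo `p^m`. -/
lemma _root_.TensorProduct.pow_dvd_of_pow_succ_dvd (hA : IsCrystalline p A)
    (hR : IsPCompletelySmooth p A R) (n : ℕ) (x : R ⊗[A] R)
    (hx : (p : R ⊗[A] R) ^ (n + 1) ∣ p * x) : (p : R ⊗[A] R) ^ n ∣ x := by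
  let m := n + 1
  let := (reductionPow p (algebraMap A R) m).toAlgebra
  let A' := A ⧸ pIdeal p A ^ m
  let R' := R ⧸ pIdeal p R ^ m
  have hflat : Module.Flat A' R' := (hR.smooth m).flat
  have : IsScalarTower A A' R' := IsScalarTower.of_algebraMap_eq fun _ => rfl
  let θ : R ⊗[A] R →ₐ[A] R' ⊗[A'] R' := Algebra.TensorProduct.productMap
    ((Algebra.TensorProduct.includeLeft (R := A') (S := A) (A := R') (B := R')).comp
      (Ideal.Quotient.mkₐ A _))
    (((Algebra.TensorProduct.includeRight (R := A') (A := R') (B := R')).restrictScalars A).comp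
      (Ideal.Quotient.mkₐ A _))
  let Q := (R ⊗[A] R) ⧸ pIdeal p (R ⊗[A] R) ^ m
  let := (reductionPow p (algebraMap A (R ⊗[A] R)) m).toAlgebra
  let f₁ : R' →ₐ[A'] Q :=
    { reductionPow p
        (Algebra.TensorProduct.includeLeft (R := A) (A := R) (B := R) (S := A)).toRingHom m with
      commutes' := fun a => by
        obtain ⟨a, rfl⟩ := Ideal.Quotient.mk_surjective a
        rfl }
  let f₂ : R' →ₐ[A'] Q :=
    { reductionPow p
        (Algebra.TensorProduct.includeRight (R := A) (A := R) (B := R)).toRingHom m with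
      commutes' := fun a => by
        obtain ⟨a, rfl⟩ := Ideal.Quotient.mk_surjective a
        exact congrArg (Ideal.Quotient.mk _)
          ((Algebra.TensorProduct.includeRight (R := A) (A := R) (B := R)).commutes a) }
  let σ : R' ⊗[A'] R' →ₐ[A'] Q := Algebra.TensorProduct.productMap f₁ f₂
  -- Only this half of `(R ⊗ R) / p^m ≅ R' ⊗ R'` is needed to carry divisibility back.
  have hσθ (x : R ⊗[A] R) : σ (θ x) = Ideal.Quotient.mk _ x := by
    induction x with
    | zero => simp
    | add x y hx hy => rw [map_add, map_add, hx, hy, map_add]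
    | tmul x y =>
      simp only [θ, Algebra.TensorProduct.productMap_apply_tmul, map_mul]
      have h1 : σ (Ideal.Quotient.mk _ x ⊗ₜ 1) = f₁ (Ideal.Quotient.mk _ x) :=
        Algebra.TensorProduct.productMap_left_apply ..
      have h2 : σ (1 ⊗ₜ Ideal.Quotient.mk _ y) = f₂ (Ideal.Quotient.mk _ y) :=
        Algebra.TensorProduct.productMap_right_apply ..
      refine (congrArg₂ (· * ·) h1 h2).trans ?_
      have h3 : x ⊗ₜ[A] y = (x ⊗ₜ 1) * (1 ⊗ₜ y) := by simp
      rw [h3, map_mul]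
      rfl
  have hp : (p : A') ^ m = 0 := by
    rw [← map_natCast (Ideal.Quotient.mk (pIdeal p A ^ m)), ← map_pow,
      Ideal.Quotient.eq_zero_iff_mem, mem_pIdeal_pow]
  have hpS : (p : R' ⊗[A'] R') ^ m = 0 := by
    rw [← map_natCast (algebraMap A' _), ← map_pow, hp, map_zero]
  have h0 : algebraMap A' (R' ⊗[A'] R') p * θ x = 0 := by
    obtain ⟨y, hy⟩ := hx
    rw [map_natCast, ← map_natCast θ, ← map_mul, hy, map_mul, map_pow, map_natCast, hpS, zero_mul]
  have key := mem_map_of_mul_eq_zero (p : A') (Ideal.span {(p : A') ^ n}) (fun s hs => by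
    obtain ⟨b, rfl⟩ := Ideal.Quotient.mk_surjective s
    rw [← map_natCast (Ideal.Quotient.mk (pIdeal p A ^ m)), ← map_mul,
      Ideal.Quotient.eq_zero_iff_mem, mem_pIdeal_pow, pow_succ'] at hs
    obtain ⟨c, hc⟩ := hs
    rw [Ideal.mem_span_singleton, hA.cancel (hc.trans (mul_assoc ..)), map_mul, map_pow, map_natCast]
    exact dvd_mul_right _ _) (θ x) h0
  rw [Ideal.map_span, Set.image_singleton, Ideal.mem_span_singleton, map_pow, map_natCast] at key
  obtain ⟨z, hz⟩ := key
  obtain ⟨w, hw⟩ := Ideal.Quotient.mk_surjective (σ z)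
  have h1 : Ideal.Quotient.mk (pIdeal p (R ⊗[A] R) ^ m) x = Ideal.Quotient.mk _ (p ^ n * w) := by
    rw [← hσθ, hz, map_mul, map_pow, map_natCast, map_mul, hw, map_pow, map_natCast]
  rw [mk_pIdeal_pow_eq] at h1
  exact (dvd_sub_left (dvd_mul_right _ _)).1 ((pow_dvd_pow _ n.le_succ).trans h1)

lemma isCrystalline (hA : IsCrystalline p A) (hR : IsPCompletelySmooth p A R) :
    IsCrystalline p (CompletedTensor p A R) :=
  PCompletion.isCrystalline (TensorProduct.pow_dvd_of_pow_succ_dvd hA hR)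

lemma algebraMap_tmul (x y : R) : algebraMap (R ⊗[A] R) (CompletedTensor p A R) (x ⊗ₜ y) =
    incl p A R 0 x * incl p A R 1 y := by
  have h : x ⊗ₜ[A] y = (x ⊗ₜ 1) * (1 ⊗ₜ y) := by simp
  rw [h, map_mul]
  rfl

lemma ringHom_ext {B : Type*} [CommRing B] [IsHausdorff (pIdeal p B) B]
    {f g : CompletedTensor p A R →+* B} (h : ∀ j r, f (incl p A R j r) = g (incl p A R j r)) :
    f = g := by
  refine PCompletion.ringHom_ext fun x => ?_
  induction x with
  | zero => simp
  | add x y hx hy => rw [map_add, map_add, map_add, hx, hy]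
  | tmul x y => rw [algebraMap_tmul, map_mul, map_mul, h, h]

lemma exists_lift {B : Type*} [CommRing B] (hB : IsAdicComplete (pIdeal p B) B)
    (g : Fin 2 → R →+* B) (hg : ∀ a, g 0 (algebraMap A R a) = g 1 (algebraMap A R a)) :
    ∃ f : CompletedTensor p A R →+* B, ∀ j r, f (incl p A R j r) = g j r := by
  let := ((g 0).comp (algebraMap A R)).toAlgebra
  let g₀ : R →ₐ[A] B := { g 0 with commutes' := fun _ => rfl }
  let g₁ : R →ₐ[A] B := { g 1 with commutes' := fun a => (hg a).symm }
  obtain ⟨f, hf⟩ := PCompletion.exists_lift hB (Algebra.TensorProduct.productMap g₀ g₁).toRingHom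
  refine ⟨f, fun j r => ?_⟩
  fin_cases j
  · exact (hf _).trans (Algebra.TensorProduct.productMap_left_apply ..)
  · exact (hf _).trans (Algebra.TensorProduct.productMap_right_apply ..)

lemma diagonal_algebraMap (hR : IsAdicComplete (pIdeal p R) R) (x : R ⊗[A] R) :
    diagonal p A R hR (algebraMap (R ⊗[A] R) _ x) = Algebra.TensorProduct.lmul' A (S := R) x := by
  refine eq_of_forall_pow_dvd_sub (p := p) fun n => ?_
  rw [← mk_pIdeal_pow_eq]
  exact AdicCompletion.mk_ofAlgEquiv_symm (pIdeal p R) n _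

lemma diagonal_incl (hR : IsAdicComplete (pIdeal p R) R) (j : Fin 2) (r : R) :
    diagonal p A R hR (incl p A R j r) = r := by
  fin_cases j
  · exact (diagonal_algebraMap hR (r ⊗ₜ 1)).trans (by simp)
  · exact (diagonal_algebraMap hR (1 ⊗ₜ r)).trans (by simp)

lemma incl_sub_incl_mem_diagonalIdeal (hR : IsAdicComplete (pIdeal p R) R) (r : R) :
    incl p A R 0 r - incl p A R 1 r ∈ diagonalIdeal p A R hR := by
  rw [diagonalIdeal, RingHom.mem_ker, map_sub, diagonal_incl, diagonal_incl, sub_self]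

/-- A map identifying the two inclusions modulo `p` factors modulo `p` over the diagonal. -/
lemma dvd_sub_diagonal (hR : IsAdicComplete (pIdeal p R) R) {B : Type*} [CommRing B]
    {g : CompletedTensor p A R →+* B}
    (hg : ∀ r, (p : B) ∣ g (incl p A R 0 r) - g (incl p A R 1 r)) (c : CompletedTensor p A R) :
    (p : B) ∣ g c - g (incl p A R 0 (diagonal p A R hR c)) := by
  have key (x : R ⊗[A] R) : (p : B) ∣ g (algebraMap _ _ x) -
      g (incl p A R 0 (diagonal p A R hR (algebraMap _ _ x))) := by
    induction x with
    | zero => simp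
    | add x y hx hy =>
      simp only [map_add, add_sub_add_comm]
      exact dvd_add hx hy
    | tmul x y =>
      simp only [algebraMap_tmul, map_mul, diagonal_incl, ← mul_sub]
      exact (dvd_sub_comm.1 (hg y)).mul_left _
  obtain ⟨x, y, hy⟩ := PCompletion.exists_pow_dvd_sub c 1
  obtain rfl : c = algebraMap _ _ x + p * y := by
    rw [← pow_one (p : CompletedTensor p A R), ← hy]; ring
  simp only [map_add, map_mul, map_natCast, add_sub_add_comm, ← mul_sub]
  exact dvd_add (key x) (dvd_mul_right _ _)

/-- Modulo `p`, a map identifying the two inclusions factors through the diagonal, hence kills `J`.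
This replaces `J` by a condition on elements of `R`. -/
lemma map_diagonalIdeal_le_iff (hR : IsAdicComplete (pIdeal p R) R) {B : Type*} [CommRing B]
    {g : CompletedTensor p A R →+* B} : (diagonalIdeal p A R hR).map g ≤ pIdeal p B ↔
      ∀ r, (p : B) ∣ g (incl p A R 0 r) - g (incl p A R 1 r) := by
  rw [Ideal.map_le_iff_le_comap]
  refine ⟨fun h r => ?_, fun h c hc => ?_⟩
  · rw [← map_sub, ← mem_pIdeal]
    exact h (incl_sub_incl_mem_diagonalIdeal hR r)
  · have h1 := dvd_sub_diagonal hR h c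
    rw [diagonalIdeal, RingHom.mem_ker] at hc
    rw [hc, map_zero, map_zero, sub_zero] at h1
    exact mem_pIdeal.2 h1

end CompletedTensor


/-! ### Frobenius on the completed tensor product -/

section DeltaStructure

variable {p : ℕ} [Fact p.Prime] {A R : Type u} [CommRing A] [CommRing R] [Algebra A R]

namespace CompletedTensor

lemma exists_deltaStructure {δA : DeltaStructure p A} (hA : IsCrystalline p A)
    (hR : IsPCompletelySmooth p A R) (δ : Fin 2 → DeltaStructure p R)
    (hδ : ∀ j, IsDeltaMap δA (δ j) (algebraMap A R)) :
    ∃ δC : DeltaStructure p (CompletedTensor p A R),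
      ∀ j, IsDeltaMap (δ j) δC (incl p A R j).toRingHom := by
  have hC := isCrystalline (p := p) hA hR
  obtain ⟨φ, hφ⟩ := exists_lift (p := p) (A := A) hC.complete
    (fun j => (incl p A R j).toRingHom.comp (δ j).frobeniusHom) (fun a => by
      have h (j : Fin 2) : incl p A R j ((δ j).frobeniusHom (algebraMap A R a)) =
          algebraMap A _ (δA.frobeniusHom a) := by
        rw [← (hδ j).frobeniusHom_apply, AlgHom.commutes]
      exact (h 0).trans (h 1).symm)
  have hincl (j r) : (p : CompletedTensor p A R) ∣ φ (incl p A R j r) - incl p A R j r ^ p := by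
    obtain ⟨x, hx⟩ := (δ j).dvd_frobeniusHom_sub r
    refine ⟨incl p A R j x, ?_⟩
    rw [hφ, ← map_natCast (incl p A R j), ← map_mul, ← hx, map_sub, map_pow]
    rfl
  obtain ⟨δC, hδC⟩ := hC.exists_deltaStructure φ (PCompletion.dvd_map_sub_pow φ fun x => by
    induction x with
    | zero => simp [(Fact.out : p.Prime).ne_zero]
    | add x y hx hy => rw [map_add]; exact dvd_map_sub_pow_add hx hy
    | tmul x y => rw [algebraMap_tmul]; exact dvd_map_sub_pow_mul (hincl 0 x) (hincl 1 y))
  exact ⟨δC, fun j => hC.isDeltaMap fun r => ((hδC _).trans (hφ j r)).symm⟩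

lemma deltaStructure_ext (hC : IsCrystalline p (CompletedTensor p A R))
    {δ : Fin 2 → DeltaStructure p R} {δC δC' : DeltaStructure p (CompletedTensor p A R)}
    (h : ∀ j, IsDeltaMap (δ j) δC (incl p A R j).toRingHom)
    (h' : ∀ j, IsDeltaMap (δ j) δC' (incl p A R j).toRingHom) : δC = δC' := by
  have := hC.complete
  refine hC.deltaStructure_ext fun x => DFunLike.congr_fun (ringHom_ext fun j r => ?_) x
  exact ((h j).frobeniusHom_apply r).symm.trans ((h' j).frobeniusHom_apply r)

/-- A map from `R ⊗̂ R` compatible with the `δ`-structures on the two factors is a `δ`-map. -/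
lemma isDeltaMap {δ : Fin 2 → DeltaStructure p R} {δC : DeltaStructure p (CompletedTensor p A R)}
    (hδC : ∀ j, IsDeltaMap (δ j) δC (incl p A R j).toRingHom) {B : Type*} [CommRing B]
    (hB : IsCrystalline p B) {δB : DeltaStructure p B} {g : CompletedTensor p A R →+* B}
    (hg : ∀ j, IsDeltaMap (δ j) δB (g.comp (incl p A R j).toRingHom)) : IsDeltaMap δC δB g := by
  have := hB.complete
  refine hB.isDeltaMap fun x => DFunLike.congr_fun
    (f := g.comp δC.frobeniusHom) (g := δB.frobeniusHom.comp g) (ringHom_ext fun j r => ?_) x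
  exact (congrArg g ((hδC j).frobeniusHom_apply r).symm).trans ((hg j).frobeniusHom_apply r)

/-- If the two Frobenius lifts agree modulo `p ^ 2`, then `φ(t ⊗ 1 - 1 ⊗ t)` becomes divisible by
`p ^ 2` wherever the diagonal ideal becomes divisible by `p`. -/
lemma sq_dvd_frobenius_sub (hR : IsCrystalline p R) {δ : Fin 2 → DeltaStructure p R}
    (hφ : ∀ x, (δ 0).frobenius x - (δ 1).frobenius x ∈ pIdeal p R ^ 2)
    {δC : DeltaStructure p (CompletedTensor p A R)}
    (hδC : ∀ j, IsDeltaMap (δ j) δC (incl p A R j).toRingHom) {B : Type*} [CommRing B]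
    {g : CompletedTensor p A R →+* B}
    (hg : ∀ r, (p : B) ∣ g (incl p A R 0 r) - g (incl p A R 1 r)) (t : R) :
    (p : B) ^ 2 ∣ g (δC.frobeniusHom (incl p A R 0 t - incl p A R 1 t)) := by
  set x := incl p A R 0 t - incl p A R 1 t with hx
  have hΔx : diagonal p A R hR.complete x = 0 := incl_sub_incl_mem_diagonalIdeal hR.complete t
  have hΔφ (j : Fin 2) : diagonal p A R hR.complete (δC.frobeniusHom (incl p A R j t)) =
      (δ j).frobeniusHom t := by
    refine (congrArg _ ((hδC j).frobeniusHom_apply t).symm).trans ?_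
    exact diagonal_incl hR.complete j _
  obtain ⟨r, hr⟩ := mem_pIdeal_pow.1 (hφ t)
  -- The diagonal kills `x`, so it sends `φ(x) = x^p + p δ(x)` to `p Δ(δ(x))`; this is also `φ₁(t) -
  -- φ₂(t) = p² r`.
  have hΔδ : diagonal p A R hR.complete (δC x) = p * r := by
    refine hR.cancel ?_
    have h1 := congrArg (diagonal p A R hR.complete) (δC.frobeniusHom_apply x)
    rw [map_add, map_pow, hΔx, zero_pow (Fact.out : p.Prime).ne_zero, zero_add, map_mul,
      map_natCast] at h1
    rw [← h1, hx, map_sub, map_sub, hΔφ, hΔφ, ← mul_assoc, ← pow_two]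
    exact hr
  have hgδ : (p : B) ∣ g (δC x) := by
    have h1 := dvd_sub_diagonal hR.complete hg (δC x)
    rw [hΔδ, map_mul, map_mul, map_natCast, map_natCast] at h1
    exact (dvd_sub_left (dvd_mul_right _ _)).1 h1
  have hgx : (p : B) ∣ g x := by
    rw [hx, map_sub]
    exact hg t
  rw [δC.frobeniusHom_apply, map_add, map_pow, map_mul, map_natCast]
  refine dvd_add ?_ ?_
  · exact (pow_dvd_pow_of_dvd hgx 2).trans (pow_dvd_pow _ (Fact.out : p.Prime).two_le)
  · rw [pow_two]
    exact mul_dvd_mul_left _ hgδ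

omit [Fact p.Prime] in
/-- A map from `R ⊗̂ R` that identifies the two inclusions modulo `p` is determined by its
restriction to one factor and its values on the differences of the coordinates. -/
lemma ringHom_ext_of_coordinates {d : ℕ} {T : Fin d → R} (hT : IsCoordinates p A T)
    {B : Type*} [CommRing B] (hB : IsCrystalline p B) {f g : CompletedTensor p A R →+* B}
    (hf : ∀ r, (p : B) ∣ f (incl p A R 0 r) - f (incl p A R 1 r))
    (hg : ∀ r, (p : B) ∣ g (incl p A R 0 r) - g (incl p A R 1 r)) (j : Fin 2)
    (hj : ∀ r, f (incl p A R j r) = g (incl p A R j r))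
    (hx : ∀ i, f (incl p A R 0 (T i) - incl p A R 1 (T i)) =
      g (incl p A R 0 (T i) - incl p A R 1 (T i))) : f = g := by
  have := hB.complete
  have hdvd {f : CompletedTensor p A R →+* B}
      (hf : ∀ r, (p : B) ∣ f (incl p A R 0 r) - f (incl p A R 1 r)) (k l : Fin 2) (r : R) :
      (p : B) ∣ f (incl p A R k r) - f (incl p A R l r) := by
    fin_cases k <;> fin_cases l
    · simp
    · exact hf r
    · exact dvd_sub_comm.1 (hf r)
    · simp
  simp only [map_sub] at hx
  have hT' (k : Fin 2) (i : Fin d) : f (incl p A R k (T i)) = g (incl p A R k (T i)) := by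
    fin_cases j <;> fin_cases k
    · exact hj _
    · have := hj (T i)
      simp only [Fin.zero_eta] at this
      change f (incl p A R 1 (T i)) = g (incl p A R 1 (T i))
      linear_combination this - hx i
    · have := hj (T i)
      simp only [Fin.mk_one] at this
      change f (incl p A R 0 (T i)) = g (incl p A R 0 (T i))
      linear_combination this + hx i
    · exact hj _
  refine ringHom_ext fun k r => DFunLike.congr_fun (f := f.comp (incl p A R k).toRingHom)
    (g := g.comp (incl p A R k).toRingHom) (hT.ringHom_ext hB (fun a => ?_) (fun r => ?_) (hT' k)) r
  · have h := hj (algebraMap A R a)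
    change f (incl p A R k _) = g (incl p A R k _)
    rwa [AlgHom.commutes, ← (incl p A R j).commutes]
  · have h := (hdvd hf k j r).sub (hdvd hg k j r)
    rwa [hj, sub_sub_sub_cancel_right] at h

end CompletedTensor

end DeltaStructure

/-! ### The structure map of the divided power polynomials -/

section PdStructureMap

open CompletedTensor PdPolynomial

variable {p : ℕ} [Fact p.Prime] {A R : Type u} [CommRing A] [CommRing R] [Algebra A R]
  {d : ℕ} {T : Fin d → R}

omit [Fact p.Prime] in
lemma IsPdStructureMap.dvd_sub {hR : IsAdicComplete (pIdeal p R) R} {j : Fin 2}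
    {ψ : CompletedTensor p A R →+* PdPolynomial p R d} (hψ : IsPdStructureMap hR T j ψ) (r : R) :
    (p : PdPolynomial p R d) ∣ ψ (incl p A R 0 r) - ψ (incl p A R 1 r) :=
  (map_diagonalIdeal_le_iff hR).1 hψ.map_le r

lemma IsPdStructureMap.eq (hA : IsCrystalline p A) (hR : IsPCompletelySmooth p A R)
    (hT : IsCoordinates p A T) {j : Fin 2}
    {ψ ψ' : CompletedTensor p A R →+* PdPolynomial p R d}
    (hψ : IsPdStructureMap hR.complete T j ψ) (hψ' : IsPdStructureMap hR.complete T j ψ') :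
    ψ = ψ' :=
  ringHom_ext_of_coordinates hT (PdPolynomial.isCrystalline (hR.isCrystalline hA)) hψ.dvd_sub
    hψ'.dvd_sub j (fun r => (hψ.map_incl r).trans (hψ'.map_incl r).symm)
    fun i => (hψ.map_sub i).trans (hψ'.map_sub i).symm

omit [Fact p.Prime] in
lemma exists_isPdStructureMap (hR : IsPCompletelySmooth p A R)
    (hT : IsCoordinates p A T) (j : Fin 2) :
    ∃ ψ : CompletedTensor p A R →+* PdPolynomial p R d, IsPdStructureMap hR.complete T j ψ := by
  have hP : IsAdicComplete (pIdeal p (PdPolynomial p R d)) _ := PCompletion.isAdicComplete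
  obtain ⟨h, hA', hmod, hj, hsub⟩ : ∃ h : Fin 2 → R →+* PdPolynomial p R d,
      (∀ k a, h k (algebraMap A R a) = algebraMap R _ (algebraMap A R a)) ∧
      -- One factor acts by the structure map; the other is its deformation within the class mod
      -- `p`, with `S_i ↦ T_i - p Y_i` or `T_i ↦ S_i + p Y_i`.
      (∀ k x, (p : PdPolynomial p R d) ∣ h k x - algebraMap R _ x) ∧
      (∀ r, h j r = algebraMap R _ r) ∧ ∀ i, h 0 (T i) - h 1 (T i) = (p : PdPolynomial p R d) * Y i := by
    fin_cases j
    · obtain ⟨f, hf, hf', hfT⟩ := hT.exists_lift hR hP (algebraMap R (PdPolynomial p R d))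
        (fun i => algebraMap R _ (T i) - (p : PdPolynomial p R d) * Y i) fun i => by simp
      refine ⟨![algebraMap R _, f], fun k a => ?_, fun k x => ?_, fun r => rfl, fun i => ?_⟩
      · fin_cases k
        exacts [rfl, hf a]
      · fin_cases k
        exacts [by simp, hf' x]
      · simp [hfT]
    · obtain ⟨f, hf, hf', hfT⟩ := hT.exists_lift hR hP (algebraMap R (PdPolynomial p R d))
        (fun i => algebraMap R _ (T i) + (p : PdPolynomial p R d) * Y i) fun i => by simp
      refine ⟨![f, algebraMap R _], fun k a => ?_, fun k x => ?_, fun r => rfl, fun i => ?_⟩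
      · fin_cases k
        exacts [hf a, rfl]
      · fin_cases k
        exacts [hf' x, by simp]
      · simp [hfT]
  obtain ⟨ψ, hψ⟩ := CompletedTensor.exists_lift (p := p) hP h
    fun a => (hA' 0 a).trans (hA' 1 a).symm
  refine ⟨ψ, fun r => (hψ j r).trans (hj r), fun i => ?_, (map_diagonalIdeal_le_iff _).2 fun r => ?_⟩
  · rw [map_sub, hψ, hψ, hsub]
  · rw [hψ, hψ]
    simpa using (hmod 0 r).sub (hmod 1 r)

/-- A prism `E` with a `δ`-map from `R ⊗̂ R` that is universal among those which identify the two
inclusions modulo `p`. -/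
structure IsUniversalPrism (δC : DeltaStructure p (CompletedTensor p A R)) {E : Type u} [CommRing E]
    (δE : DeltaStructure p E) (f : CompletedTensor p A R →+* E) : Prop where
  isCrystalline : IsCrystalline p E
  isDeltaMap : IsDeltaMap δC δE f
  dvd_sub : ∀ r, (p : E) ∣ f (incl p A R 0 r) - f (incl p A R 1 r)
  existsUnique_lift : ∀ (B : Type u) [CommRing B] (δB : DeltaStructure p B), IsCrystalline p B →
    ∀ g : CompletedTensor p A R →+* B, IsDeltaMap δC δB g →
      (∀ r, (p : B) ∣ g (incl p A R 0 r) - g (incl p A R 1 r)) →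
      ∃! h : E →+* B, IsDeltaMap δE δB h ∧ h.comp f = g

/-- The divided power polynomials are the universal prism. -/
lemma exists_isUniversalPrism (hA : IsCrystalline p A)
    (hR : IsPCompletelySmooth p A R) (hT : IsCoordinates p A T) {δ : Fin 2 → DeltaStructure p R}
    (hφ : ∀ x, (δ 0).frobenius x - (δ 1).frobenius x ∈ pIdeal p R ^ 2)
    {δC : DeltaStructure p (CompletedTensor p A R)}
    (hδC : ∀ j, IsDeltaMap (δ j) δC (incl p A R j).toRingHom) {j : Fin 2}
    {ψ : CompletedTensor p A R →+* PdPolynomial p R d}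
    (hψ : IsPdStructureMap hR.complete T j ψ) :
    ∃ δP : DeltaStructure p (PdPolynomial p R d), IsUniversalPrism δC δP ψ := by
  have hRc := hR.isCrystalline hA
  have hP : IsCrystalline p (PdPolynomial p R d) := PdPolynomial.isCrystalline hRc
  have hinclφ (r : R) : δC.frobeniusHom (incl p A R j r) = incl p A R j ((δ j).frobeniusHom r) :=
    ((hδC j).frobeniusHom_apply r).symm
  choose w hw using fun i => sq_dvd_frobenius_sub hRc hφ hδC hψ.dvd_sub (T i)
  -- The value is forced: `p φ(Y_i) = ψ(φ(T_i - S_i)) = p² w_i`.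
  obtain ⟨F, hFR, hFY⟩ := PdPolynomial.exists_lift hP
    ((algebraMap R (PdPolynomial p R d)).comp (δ j).frobeniusHom) (fun i => p * w i)
    fun i => hP.hasDividedPowers_of_dvd (dvd_mul_right _ _)
  obtain ⟨δP, hδP⟩ := hP.exists_deltaStructure F (PdPolynomial.dvd_sub_pow hRc F
    (fun r => by
      obtain ⟨x, hx⟩ := (δ j).dvd_frobeniusHom_sub r
      refine ⟨algebraMap R _ x, ?_⟩
      rw [hFR, ← map_natCast (algebraMap R (PdPolynomial p R d)), ← map_mul, ← hx, map_sub, map_pow]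
      rfl)
    fun i => by rw [hFY]; exact dvd_mul_right _ _)
  have hψδ : IsDeltaMap δC δP ψ := by
    refine hP.isDeltaMap fun c => ?_
    rw [hδP]
    -- By rigidity it is enough to compare on the `j`-th factor and the `T_i - S_i`, where `F` was
    -- prescribed; compatibility with the other Frobenius lift follows.
    refine DFunLike.congr_fun (f := ψ.comp δC.frobeniusHom) (g := F.comp ψ)
      (ringHom_ext_of_coordinates hT hP (fun r => ?_) (fun r => ?_) j (fun r => ?_) fun i => ?_) c
    · rw [← map_sub, RingHom.comp_apply, δC.frobeniusHom_apply, map_add, map_mul, map_natCast,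
        map_pow, map_sub]
      exact dvd_add ((hψ.dvd_sub r).trans (dvd_pow_self _ (Fact.out : p.Prime).ne_zero))
        (dvd_mul_right _ _)
    · rw [← map_sub, RingHom.comp_apply, map_sub]
      obtain ⟨z, hz⟩ := hψ.dvd_sub r
      rw [hz, map_mul, map_natCast]
      exact dvd_mul_right _ _
    · rw [RingHom.comp_apply, RingHom.comp_apply, hinclφ, hψ.map_incl, hψ.map_incl, hFR]
      rfl
    · rw [RingHom.comp_apply, RingHom.comp_apply, hw, hψ.map_sub, map_mul, map_natCast, hFY, pow_two,
        mul_assoc]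
  refine ⟨δP, hP, hψδ, hψ.dvd_sub, fun B _ δB hB g hgδ hg => ?_⟩
  choose y hy using fun i => hg (T i)
  have hy' (i) : g (incl p A R 0 (T i) - incl p A R 1 (T i)) = p * y i := by rw [map_sub, hy]
  have hyp (i) : (p : B) ∣ y i ^ p := by
    have h1 : (p : B) ∣ δB.frobeniusHom (y i) := by
      have h2 := sq_dvd_frobenius_sub hRc hφ hδC hg (T i)
      rw [hgδ.frobeniusHom_apply, hy', map_mul, map_natCast, pow_two, ← pow_two] at h2
      have h3 := hB.dvd_of_pow_mul_dvd (n := 1) (m := 1) (by rw [pow_one]; exact h2)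
      rwa [pow_one] at h3
    exact (dvd_sub_right h1).1 (δB.dvd_frobeniusHom_sub (y i))
  obtain ⟨h, hhR, hhY⟩ := PdPolynomial.exists_lift hB (g.comp (incl p A R j).toRingHom) y
    fun i => hB.hasDividedPowers_of_dvd_pow δB (hyp i)
  have hhψ : h.comp ψ = g := by
    refine ringHom_ext_of_coordinates hT hB (fun r => ?_) hg j (fun r => ?_) fun i => ?_
    · obtain ⟨z, hz⟩ := hψ.dvd_sub r
      rw [RingHom.comp_apply, RingHom.comp_apply, ← map_sub h, hz, map_mul, map_natCast]
      exact dvd_mul_right _ _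
    · rw [RingHom.comp_apply, hψ.map_incl, hhR]
      rfl
    · rw [RingHom.comp_apply, hψ.map_sub, hy', map_mul, map_natCast, hhY]
  have hhψ' (c) : h (ψ c) = g c := DFunLike.congr_fun hhψ c
  refine ⟨h, ⟨hB.isDeltaMap fun c => DFunLike.congr_fun (f := h.comp δP.frobeniusHom)
    (g := δB.frobeniusHom.comp h) (PdPolynomial.ringHom_ext hB (fun r => ?_) fun i => ?_) c, hhψ⟩,
    fun h' hh' => ?_⟩
  · rw [RingHom.comp_apply, RingHom.comp_apply, ← hψ.map_incl, ← hψδ.frobeniusHom_apply, hhψ', hhψ',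
      hgδ.frobeniusHom_apply]
  -- `p Y_i` comes from `R ⊗̂ R`, where compatibility is known; then `p` is cancelled.
  · refine hB.cancel ?_
    have h1 := congrArg h (hψδ.frobeniusHom_apply (incl p A R 0 (T i) - incl p A R 1 (T i)))
    rw [hhψ', hgδ.frobeniusHom_apply, hy', hψ.map_sub] at h1
    simpa [hhY] using h1.symm
  · have h1 (c) : h' (ψ c) = g c := DFunLike.congr_fun hh'.2 c
    refine PdPolynomial.ringHom_ext hB (fun r => ?_) fun i => hB.cancel ?_
    · rw [← hψ.map_incl, h1, hhψ']
    · rw [← map_natCast h', ← map_mul, map_natCast, ← hψ.map_sub, h1, ← hhψ', hψ.map_sub]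
      simp

end PdStructureMap


/-! ### Envelope and coproduct from the universal property -/

section UniversalPrism

open CompletedTensor

variable {p : ℕ} [Fact p.Prime] {A R : Type u} [CommRing A] [CommRing R] [Algebra A R]
  {δC : DeltaStructure p (CompletedTensor p A R)}

namespace IsUniversalPrism

omit [Fact p.Prime] in
lemma ringHom_ext {E B : Type u} [CommRing E] [CommRing B] {δE : DeltaStructure p E}
    {f : CompletedTensor p A R →+* E} (hf : IsUniversalPrism δC δE f) {δB : DeltaStructure p B}
    (hB : IsCrystalline p B) {h h' : E →+* B} (hh : IsDeltaMap δE δB h) (hh' : IsDeltaMap δE δB h')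
    (hf' : h.comp f = h'.comp f) : h = h' := by
  refine (hf.existsUnique_lift B δB hB (h'.comp f) (fun c => ?_) fun r => ?_).unique
    ⟨hh, hf'⟩ ⟨hh', rfl⟩
  · exact (congrArg h' (hf.isDeltaMap c)).trans (hh' (f c))
  · obtain ⟨z, hz⟩ := hf.dvd_sub r
    exact ⟨h' z, by rw [RingHom.comp_apply, RingHom.comp_apply, ← map_sub, hz, map_mul, map_natCast]⟩

omit [Fact p.Prime] in
lemma exists_ringEquiv {E E' : Type u} [CommRing E] [CommRing E'] {δE : DeltaStructure p E}
    {δE' : DeltaStructure p E'} {f : CompletedTensor p A R →+* E}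
    {f' : CompletedTensor p A R →+* E'} (hf : IsUniversalPrism δC δE f)
    (hf' : IsUniversalPrism δC δE' f') : ∃ e : E ≃+* E', ∀ c, e (f c) = f' c := by
  obtain ⟨h, ⟨hδ, hh⟩, -⟩ :=
    hf.existsUnique_lift E' δE' hf'.isCrystalline f' hf'.isDeltaMap hf'.dvd_sub
  obtain ⟨h', ⟨hδ', hh'⟩, -⟩ :=
    hf'.existsUnique_lift E δE hf.isCrystalline f hf.isDeltaMap hf.dvd_sub
  have h1 : h'.comp h = RingHom.id E := hf.ringHom_ext hf.isCrystalline
    (fun x => (congrArg h' (hδ x)).trans (hδ' _)) (fun _ => rfl)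
    (by rw [RingHom.comp_assoc, hh, hh', RingHom.id_comp])
  have h2 : h.comp h' = RingHom.id E' := hf'.ringHom_ext hf'.isCrystalline
    (fun x => (congrArg h (hδ' x)).trans (hδ _)) (fun _ => rfl)
    (by rw [RingHom.comp_assoc, hh', hh, RingHom.id_comp])
  exact ⟨RingEquiv.ofRingHom h h' h2 h1, fun c => DFunLike.congr_fun hh c⟩

variable {δA : DeltaStructure p A} {δ : Fin 2 → DeltaStructure p R}

omit [Fact p.Prime] in
-- The `A`-structures need no separate care: `A` acts on `E` and on `B` through `R ⊗̂ R`, so the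
-- lift is automatically `A`-linear.
lemma isPrismaticEnvelope (hR : IsAdicComplete (pIdeal p R) R)
    (hδ : ∀ j, IsDeltaMap δA (δ j) (algebraMap A R))
    (hδC : ∀ j, IsDeltaMap (δ j) δC (incl p A R j).toRingHom) {E : Type u} [CommRing E]
    [Algebra A E] {δE : DeltaStructure p E} {f : CompletedTensor p A R →ₐ[A] E}
    (hf : IsUniversalPrism δC δE f.toRingHom) :
    IsPrismaticEnvelope δA δC (diagonalIdeal p A R hR) δE f where
  isCrystalline := hf.isCrystalline
  isDeltaMap_algebraMap a := by
    have h (a : A) : algebraMap A E a = f (incl p A R 0 (algebraMap A R a)) := by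
      rw [AlgHom.commutes, AlgHom.commutes]
    rw [h, h, hδ 0]
    exact (congrArg f (hδC 0 _)).trans (hf.isDeltaMap _)
  isDeltaMap := hf.isDeltaMap
  map_le := (map_diagonalIdeal_le_iff hR (g := f.toRingHom)).2 hf.dvd_sub
  existsUnique_lift B _ _ δB hB _ g hg hgJ := by
    obtain ⟨h, ⟨hδh, hh⟩, -⟩ := hf.existsUnique_lift B δB hB g.toRingHom hg
      ((map_diagonalIdeal_le_iff hR (g := g.toRingHom)).1 hgJ)
    have hc (c) : h (f c) = g c := DFunLike.congr_fun hh c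
    refine ⟨{ h with commutes' := fun a => ?_ }, ⟨hδh, AlgHom.ext hc⟩, fun h' hh' => ?_⟩
    · have := hc (algebraMap A _ a)
      rwa [AlgHom.commutes, AlgHom.commutes] at this
    · have := hf.ringHom_ext hB hh'.1 hδh (RingHom.ext fun c =>
        (DFunLike.congr_fun hh'.2 c).trans (hc c).symm)
      exact AlgHom.ext fun x => DFunLike.congr_fun this x

/-- The universal prism is the coproduct of the two factors. -/
lemma nonempty_isColimit (hA : IsCrystalline p A) (hR : IsPCompletelySmooth p A R)
    (hδ : ∀ j, IsDeltaMap δA (δ j) (algebraMap A R))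
    (hδC : ∀ j, IsDeltaMap (δ j) δC (incl p A R j).toRingHom)
    {E : PrismObj δA (R ⧸ pIdeal p R)} (q : ∀ j, PrismObj.ofDelta hA hR (δ j) (hδ j) ⟶ E)
    {f : CompletedTensor p A R →ₐ[A] E.carrier} (hfq : ∀ j r, f (incl p A R j r) = (q j).toAlgHom r)
    (hf : IsUniversalPrism δC E.δ f.toRingHom) :
    Nonempty (Limits.IsColimit (Limits.BinaryCofan.mk (q 0) (q 1))) := by
  have hstr {X : PrismObj δA (R ⧸ pIdeal p R)} {j : Fin 2}
      (u : PrismObj.ofDelta hA hR (δ j) (hδ j) ⟶ X) (r : R) :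
      Ideal.Quotient.mk _ (u.toAlgHom r) = X.str (Ideal.Quotient.mk _ r) :=
    DFunLike.congr_fun u.reduction_comp_str (Ideal.Quotient.mk _ r)
  have key (X : PrismObj δA (R ⧸ pIdeal p R))
      (u : ∀ j, PrismObj.ofDelta hA hR (δ j) (hδ j) ⟶ X) :
      ∃ h : E ⟶ X, ∀ j, q j ≫ h = u j := by
    obtain ⟨g, hg⟩ := CompletedTensor.exists_lift (p := p) X.isCrystalline.complete
      (fun j => (u j).toAlgHom.toRingHom)
      fun a => ((u 0).toAlgHom.commutes a).trans ((u 1).toAlgHom.commutes a).symm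
    have hgδ : IsDeltaMap δC X.δ g := CompletedTensor.isDeltaMap hδC X.isCrystalline fun j r => by
      change g (incl p A R j _) = X.δ (g (incl p A R j r))
      rw [hg, hg]
      exact (u j).isDeltaMap r
    have hgJ (r : R) : (p : X.carrier) ∣ g (incl p A R 0 r) - g (incl p A R 1 r) := by
      rw [hg, hg, ← mk_pIdeal_eq]
      exact (hstr (u 0) r).trans (hstr (u 1) r).symm
    obtain ⟨h, ⟨hδh, hh⟩, -⟩ := hf.existsUnique_lift X.carrier X.δ X.isCrystalline g hgδ hgJ
    have hq (j r) : h ((q j).toAlgHom r) = (u j).toAlgHom r := by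
      rw [← hfq]
      exact (DFunLike.congr_fun hh _).trans (hg j r)
    let h' : E.carrier →ₐ[A] X.carrier :=
      { h with
        commutes' := fun a => by
          have := hq 0 (algebraMap A R a)
          rw [(q 0).toAlgHom.commutes a, (u 0).toAlgHom.commutes a] at this
          exact this }
    refine ⟨(⟨h', hδh, ?_⟩ : PrismHom E X), fun j => PrismHom.ext (AlgHom.ext fun r => hq j r)⟩
    ext x
    obtain ⟨r, rfl⟩ := Ideal.Quotient.mk_surjective x
    rw [AlgHom.comp_apply, ← hstr (q 0), ← hstr (u 0), ← hq]
    rfl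
  -- The type of the `j`-th leg depends on `j`, so the pair is packed with dependent `Fin.cons`.
  refine ⟨Limits.BinaryCofan.IsColimit.mk _
    (fun {X} u v => (key X (Fin.cons u (Fin.cons v finZeroElim))).choose)
    (fun {X} u v => (key X (Fin.cons u (Fin.cons v finZeroElim))).choose_spec 0)
    (fun {X} u v => (key X (Fin.cons u (Fin.cons v finZeroElim))).choose_spec 1)
    fun {X} u v m hu hv => ?_⟩
  set m' := (key X (Fin.cons u (Fin.cons v finZeroElim))).choose
  have hm' := (key X (Fin.cons u (Fin.cons v finZeroElim))).choose_spec
  have hX := X.isCrystalline.complete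
  have hq (j) : q j ≫ m = q j ≫ m' := by
    rw [hm']
    fin_cases j
    exacts [hu, hv]
  have := hf.ringHom_ext X.isCrystalline m.isDeltaMap m'.isDeltaMap
    (CompletedTensor.ringHom_ext fun j r => by
      change m.toAlgHom (f (incl p A R j r)) = m'.toAlgHom (f (incl p A R j r))
      rw [hfq]
      exact DFunLike.congr_fun (congrArg PrismHom.toAlgHom (hq j)) r)
  exact PrismHom.ext (AlgHom.ext fun x => DFunLike.congr_fun this x)

end IsUniversalPrism

end UniversalPrism

end CrysPrism

/-! ### The main theorem -/

open CrysPrism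
theorem proposition3p6 {p : ℕ} [Fact p.Prime] {A R : Type u} [CommRing A] [CommRing R]
    [Algebra A R]
    -- the crystalline prism `(A, (p))` and the `p`-completely smooth `A`-algebra `R`
    (δA : DeltaStructure p A) (hA : IsCrystalline p A)
    (hR : IsPCompletelySmooth p A R)
    -- the chart on `R₀ = R / p` and the coordinates on `R`
    {d : ℕ} (box : LaurentRing (A ⧸ pIdeal p A) d →ₐ[A]
      R ⧸ pIdeal p R) (hbox : box.toRingHom.Etale)
    (T : Fin d → R)
    (hT : ∀ i, Ideal.Quotient.mk (pIdeal p R) (T i) = box (LaurentRing.X i))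
    -- the two `δ`-structures on `R`
    (δ : Fin 2 → DeltaStructure p R)
    (hδ : ∀ j, IsDeltaMap δA (δ j) (algebraMap A R))
    (hφ : ∀ x, (δ 0).frobenius x - (δ 1).frobenius x ∈ pIdeal p R ^ 2) :
    -- the `δ`-structure on `R₁ ⊗̂_A R₂`
    ∃ δC : DeltaStructure p (CompletedTensor p A R),
      (∀ δ' : DeltaStructure p (CompletedTensor p A R),
        (∀ j, IsDeltaMap (δ j) δ' (incl p A R j).toRingHom) ↔ δ' = δC) ∧
    -- the coproduct of `(R₁, (p))` and `(R₂, (p))` exists and is the prismatic envelope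
    ∃ (E : PrismObj δA (R ⧸ pIdeal p R))
      (q : ∀ j, PrismObj.ofDelta hA hR (δ j) (hδ j) ⟶ E)
      (f : CompletedTensor p A R →ₐ[A] E.carrier),
      Nonempty (Limits.IsColimit
        (Limits.BinaryCofan.mk (q 0) (q 1))) ∧
      (∀ j r, f (incl p A R j r) = (q j).toAlgHom r) ∧
      IsPrismaticEnvelope δA δC (diagonalIdeal p A R hR.complete) E.δ f ∧
    -- for either `j`, it is `R_j[Y₁, …, Y_d]_pd^∧` as an `R ⊗̂_A R`-algebra
      ∀ j : Fin 2, ∃ ψ : CompletedTensor p A R →+* PdPolynomial p R d,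
        (∀ ψ', IsPdStructureMap hR.complete T j ψ' ↔ ψ' = ψ) ∧
        ∃! ι : PdPolynomial p R d ≃+* E.carrier,
          (∀ r, ι (algebraMap R _ r) = (q j).toAlgHom r) ∧
          (∀ i, (p : E.carrier) * ι (PdPolynomial.Y i) =
            f (incl p A R 0 (T i) - incl p A R 1 (T i))) ∧
          (∀ c, ι (ψ c) = f c) := by
  have hT' : IsCoordinates p A T := ⟨box, hbox, hT⟩
  have hRc := hR.isCrystalline hA
  have hP : IsCrystalline p (PdPolynomial p R d) := PdPolynomial.isCrystalline hRc
  obtain ⟨δC, hδC⟩ := CompletedTensor.exists_deltaStructure hA hR δ hδ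
  refine ⟨δC, fun δ' => ⟨fun h => CompletedTensor.deltaStructure_ext
    (CompletedTensor.isCrystalline hA hR) h hδC, fun h => h ▸ hδC⟩, ?_⟩
  choose ψ hψ using exists_isPdStructureMap hR hT'
  choose δP hδP using fun j => exists_isUniversalPrism hA hR hT' hφ hδC (hψ j)
  let : Algebra A (PdPolynomial p R d) :=
    ((algebraMap R (PdPolynomial p R d)).comp (algebraMap A R)).toAlgebra
  let f : CompletedTensor p A R →ₐ[A] PdPolynomial p R d :=
    { ψ 0 with
      commutes' := fun a => by
        have := (hψ 0).map_incl (algebraMap A R a)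
        rwa [AlgHom.commutes] at this }
  have hf : IsUniversalPrism δC (δP 0) f.toRingHom := hδP 0
  have henv := hf.isPrismaticEnvelope hR.complete hδ hδC
  -- The envelope is realised by the model for `j = 0`; using the other inclusion in `str` would
  -- give the same map, as `f` identifies the two mod `p`.
  let E : PrismObj δA (R ⧸ pIdeal p R) :=
    { carrier := PdPolynomial p R d
      δ := δP 0
      isCrystalline := hP
      isDeltaMap := henv.isDeltaMap_algebraMap
      str := reduction p (f.comp (incl p A R 0)) }
  let q (j : Fin 2) : PrismObj.ofDelta hA hR (δ j) (hδ j) ⟶ E :=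
    { toAlgHom := f.comp (incl p A R j)
      isDeltaMap := fun r => (congrArg f (hδC j r)).trans (hf.isDeltaMap _)
      reduction_comp_str := by
        ext x
        obtain ⟨r, rfl⟩ := Ideal.Quotient.mk_surjective x
        refine (mk_pIdeal_eq (x := f (incl p A R j r)) (y := f (incl p A R 0 r))).2 ?_
        fin_cases j
        · simp
        · exact dvd_sub_comm.1 (hf.dvd_sub r) }
  refine ⟨E, q, f, hf.nonempty_isColimit hA hR hδ hδC q (fun _ _ => rfl), fun _ _ => rfl, henv,
    fun j => ⟨ψ j, fun ψ' => ⟨fun h => h.eq hA hR hT' (hψ j), fun h => h ▸ hψ j⟩, ?_⟩⟩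
  -- The models for `j` and for `0` are universal for the same problem.
  obtain ⟨ι, hι⟩ := (hδP j).exists_ringEquiv (f' := f.toRingHom) hf
  replace hι : ∀ c, ι (ψ j c) = f c := hι
  refine ⟨ι, ⟨fun r => ?_, fun i => ?_, hι⟩, fun ι' hι' => ?_⟩
  · rw [← (hψ j).map_incl, hι]
    rfl
  · rw [← hι, (hψ j).map_sub, map_mul, map_natCast]
  · refine RingEquiv.ext fun x => DFunLike.congr_fun (f := ι'.toRingHom) (g := ι.toRingHom)
      (PdPolynomial.ringHom_ext hP (fun r => ?_) fun i => hP.cancel ?_) x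
    · refine (hι'.1 r).trans ?_
      change _ = ι _
      rw [← (hψ j).map_incl, hι]
      rfl
    · refine (hι'.2.1 i).trans ?_
      change _ = (p : PdPolynomial p R d) * ι _
      rw [← map_natCast ι, ← map_mul, ← (hψ j).map_sub, hι]
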